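/- Let $S_1,\dots,S_N:\mathbb R^d\to\mathbb R^d$ be contracting similarities with ratios $r_1,\dots,r_N\in(0,1)$ and let $(p_1,\dots,p_N)$ be a probability vector with all $p_i>0$; let $K$ and $\mu$ be the associated self-similar set and self-similar measure. (The objects below depend on $K$ and $\mu$ only through $d$, the $r_i$ and the $p_i$.) Put $r_{\min}=\min_i r_i$. For a finite non-empty word $\mathbf i=i_1\dots i_m$ over $\{1,\dots,N\}$ write $r_{\mathbf i}=r_{i_1}\cdots r_{i_m}$, $p_{\mathbf i}=p_{i_1}\cdots p_{i_m}$ and $\hat{\mathbf i}=i_1\dots i_{m-1}$, with $r_{\hat{\mathbf i}}=1$ if $m=1$. Fix $q\in\mathbb R$ and let $\beta(q)$ be the unique real number with $\sum_i p_i^q r_i^{\beta(q)}=1$. For $l=0,\dots,d$ let $\sigma_{q,l}=\sum_i p_i^q r_i^{l-dq}$ and, for $r>0$, $$C^{q,l,\mathrm{sym}}_{\mu,r}(K)=\sum_{r_{\mathbf i}<r<r_{\hat{\mathbf i}}}p_{\mathbf i}^q r_{\mathbf i}^{l-dq}+\tfrac12\Big(1+\tfrac1{\sigma_{q,l}}\Big)\sum_{r=r_{\hat{\mathbf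 i}}}p_{\mathbf i}^q r_{\mathbf i}^{l-dq}.$$ Let $\kappa_0,\dots,\kappa_d$ be real numbers with $\sum_{l}\kappa_l(\sigma_{q,l}-1)=0$. The symbolic multifractal Minkowski volume is $$V^{q,\mathrm{sym}}_{\mu,r}(K)=\frac1{r^d}\sum_{l=0}^d\kappa_l\,C^{q,l,\mathrm{sym}}_{\mu,r}(K)\,r^{(d-l)+dq}.$$ The multifractal zeta function is $\zeta^q_\mu(s)=\sum_{\mathbf i}p_{\mathbf i}^q r_{\mathbf i}^s$ for $\operatorname{Re}s>\beta(q)$, extended meromorphically to $\mathbb C$ by $$\zeta^q_\mu(s)=\frac{\sum_i p_i^q r_i^s}{1-\sum_i p_i^q r_i^s},$$ and the modified zeta function is $$Z^q_\mu(s)=\Big(\sum_{l=0}^d\frac{\kappa_l(\sigma_{q,l}-1)}{s-(l-dq)}\Big)\zeta^q_\mu(s).$$ Let $P(\zeta^q_\mu)$ be the set of poles of $\zeta^q_\mu$. Call a nondecreasing sequence $(t_n)_n$ of positive reals with $t_n\to\infty$ a growth sequence for $q$ if $\sum_i p_i^q r_i^{\sigma\pm\mathrm i t_n}\neq1$ for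 all $n$ and all real $\sigma$, and if for every $c\in\mathbb R$ there is a constant $k_c$ with $|\zeta^q_\mu(\sigma\pm\mathrm i t_n)|\le k_c$ for all real $\sigma\le c$ and all $n$. **Theorem 5.5.** Assume that $\beta(q)\notin\{-dq,1-dq,\dots,d-dq\}$. Then, for every real $\tau$, only finitely many poles $\omega$ of $\zeta^q_\mu$ satisfy $|\operatorname{Im}\omega|\le\tau$; there is a strictly increasing growth sequence for $q$; and for every growth sequence $(t_{q,n})_n$ for $q$ and all $0<r<r_{\min}$, $$V^{q,\mathrm{sym}}_{\mu,r}(K)=\lim_{n\to\infty}\ \sum_{\omega\in P(\zeta^q_\mu),\ |\operatorname{Im}\omega|\le t_{q,n}}\operatorname{res}\big(s\mapsto Z^q_\mu(s)\,r^{-s};\,\omega\big).$$ -/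

import Mathlib

open Filter Topology Complex

noncomputable section

/-- A list `(S₁, …, S_N, p₁, …, p_N)` of contracting similarities of `ℝ^d` with ratios
`rᵢ ∈ (0,1)` and a probability vector with positive entries. -/
structure SelfSimilarSystem (d N : ℕ) where
  /-- the similarities `Sᵢ` -/
  map : Fin N → EuclideanSpace ℝ (Fin d) → EuclideanSpace ℝ (Fin d)
  /-- the contraction ratios `rᵢ` -/
  ratio : Fin N → ℝ
  /-- the probabilities `pᵢ` -/
  prob : Fin N → ℝ
  ratio_pos : ∀ i, 0 < ratio i
  ratio_lt_one : ∀ i, ratio i < 1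
  dist_map : ∀ i x y, dist (map i x) (map i y) = ratio i * dist x y
  prob_pos : ∀ i, 0 < prob i
  sum_prob : ∑ i, prob i = 1

namespace SelfSimilarSystem

variable {d N : ℕ}

/-- `r_min = min_i rᵢ`. -/
def ratioMin (T : SelfSimilarSystem d N) : ℝ := ⨅ i, T.ratio i

/-- `r_𝐢 = r_{i₁} ⋯ r_{i_m}` for a finite word `𝐢` (equal to `1` for the empty word). -/
def wordRatio (T : SelfSimilarSystem d N) (w : List (Fin N)) : ℝ := (w.map T.ratio).prod

/-- `p_𝐢 = p_{i₁} ⋯ p_{i_m}` for a finite word `𝐢`. -/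
def wordProb (T : SelfSimilarSystem d N) (w : List (Fin N)) : ℝ := (w.map T.prob).prod

/-- `∑ᵢ pᵢ^q rᵢ^t` for real `t`. -/
def pressure (T : SelfSimilarSystem d N) (q t : ℝ) : ℝ :=
  ∑ i, T.prob i ^ q * T.ratio i ^ t

theorem nonempty_index (T : SelfSimilarSystem d N) : Nonempty (Fin N) := by
  by_contra h
  rw [not_nonempty_iff] at h
  have := T.sum_prob
  simp at this

theorem pressure_strictAnti (T : SelfSimilarSystem d N) (q : ℝ) :
    StrictAnti (T.pressure q) := by
  intro a b hab
  have := T.nonempty_index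
  refine Finset.sum_lt_sum_of_nonempty Finset.univ_nonempty fun i _ => ?_
  exact mul_lt_mul_of_pos_left
    (Real.rpow_lt_rpow_of_exponent_gt (T.ratio_pos i) (T.ratio_lt_one i) hab)
    (Real.rpow_pos_of_pos (T.prob_pos i) q)

theorem existsUnique_pressure_eq_one (T : SelfSimilarSystem d N) (q : ℝ) :
    ∃! t : ℝ, T.pressure q t = 1 := by
  obtain ⟨i₀⟩ := T.nonempty_index
  have hcont : Continuous (T.pressure q) := by
    refine continuous_finsetSum _ fun i _ => ?_
    exact continuous_const.mul (Real.continuous_const_rpow (T.ratio_pos i).ne')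
  have h0 : Tendsto (T.pressure q) atTop (𝓝 0) := by
    have : Tendsto (T.pressure q) atTop (𝓝 (∑ i : Fin N, T.prob i ^ q * 0)) := by
      refine tendsto_finsetSum _ fun i _ => ?_
      exact (tendsto_rpow_atTop_of_base_lt_one _ (by linarith [T.ratio_pos i])
        (T.ratio_lt_one i)).const_mul _
    simpa using this
  obtain ⟨a, ha⟩ := (h0.eventually (gt_mem_nhds one_pos)).exists
  have h1 : Tendsto (fun t : ℝ => T.prob i₀ ^ q * T.ratio i₀ ^ t) atBot atTop :=
    (tendsto_rpow_atBot_of_base_lt_one _ (T.ratio_pos i₀)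
      (T.ratio_lt_one i₀)).const_mul_atTop (Real.rpow_pos_of_pos (T.prob_pos i₀) q)
  obtain ⟨b, hb⟩ := (h1.eventually_ge_atTop 1).exists
  have hb' : 1 ≤ T.pressure q b := by
    refine hb.trans (Finset.single_le_sum (f := fun i => T.prob i ^ q * T.ratio i ^ b)
      (fun i _ => ?_) (Finset.mem_univ i₀))
    exact mul_nonneg (Real.rpow_nonneg (T.prob_pos i).le _) (Real.rpow_nonneg (T.ratio_pos i).le _)
  obtain ⟨t, ht⟩ := mem_range_of_exists_le_of_exists_ge hcont ⟨a, ha.le⟩ ⟨b, hb'⟩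
  exact ⟨t, ht, fun s hs => (T.pressure_strictAnti q).injective (hs.trans ht.symm)⟩

/-- `β(q)`: the unique real number with `∑ᵢ pᵢ^q rᵢ^{β(q)} = 1`. -/
def beta (T : SelfSimilarSystem d N) (q : ℝ) : ℝ :=
  (T.existsUnique_pressure_eq_one q).choose

theorem pressure_beta (T : SelfSimilarSystem d N) (q : ℝ) : T.pressure q (T.beta q) = 1 :=
  (T.existsUnique_pressure_eq_one q).choose_spec.1

/-- `σ_{q,l} = ∑ᵢ pᵢ^q rᵢ^{l - dq}`. -/
def sigma (T : SelfSimilarSystem d N) (q : ℝ) (l : ℕ) : ℝ := T.pressure q (l - d * q)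

/-- The words over which the sums in `symCount` run form a finite set for every `r > 0`. -/
theorem finite_words (T : SelfSimilarSystem d N) {r : ℝ} (hr : 0 < r) :
    {w : List (Fin N) | w ≠ [] ∧ r ≤ T.wordRatio w.dropLast}.Finite := by
  have := T.nonempty_index
  obtain ⟨j, hj⟩ := Finite.exists_max T.ratio
  have key : ∀ u : List (Fin N), T.wordRatio u ≤ T.ratio j ^ u.length := by
    intro u
    induction u with
    | nil => simp [wordRatio]
    | cons a u ih =>
      have h1 : T.wordRatio (a :: u) = T.ratio a * T.wordRatio u := by simp [wordRatio]
      have h2 : 0 ≤ T.wordRatio u := by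
        refine List.prod_nonneg fun x hx => ?_
        obtain ⟨i, _, rfl⟩ := List.mem_map.1 hx
        exact (T.ratio_pos i).le
      rw [h1, List.length_cons, pow_succ']
      exact mul_le_mul (hj a) ih h2 (T.ratio_pos j).le
  obtain ⟨n, hn⟩ := exists_pow_lt_of_lt_one hr (T.ratio_lt_one j)
  refine (List.finite_length_le (Fin N) n).subset ?_
  rintro w ⟨hw, hrw⟩
  have h1 := hrw.trans (key _)
  have h2 : w.dropLast.length < n := by
    by_contra hlt
    push Not at hlt
    have := pow_le_pow_of_le_one (T.ratio_pos j).le (T.ratio_lt_one j).le hlt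
    linarith
  rw [List.length_dropLast] at h2
  simp only [Set.mem_ofPred_eq]
  omega

/-- `C^{q,l,sym}_{μ,r}(K)`; the parent of the nonempty word `w` is `w.dropLast`. -/
def symCount (T : SelfSimilarSystem d N) (q : ℝ) (l : ℕ) (r : ℝ) : ℝ :=
  (∑ᶠ w ∈ {w : List (Fin N) | w ≠ [] ∧ T.wordRatio w < r ∧ r < T.wordRatio w.dropLast},
      T.wordProb w ^ q * T.wordRatio w ^ ((l : ℝ) - d * q))
  + (1 + 1 / T.sigma q l) / 2 *
    ∑ᶠ w ∈ {w : List (Fin N) | w ≠ [] ∧ r = T.wordRatio w.dropLast},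
      T.wordProb w ^ q * T.wordRatio w ^ ((l : ℝ) - d * q)

/-- The consistency condition `∑_l κ_l (σ_{q,l} - 1) = 0`. -/
def IsConsistent (T : SelfSimilarSystem d N) (q : ℝ) (κ : Fin (d + 1) → ℝ) : Prop :=
  ∑ l, κ l * (T.sigma q l - 1) = 0

/-- The symbolic multifractal Minkowski volume
`V^{q,sym}_{μ,r}(K) = r^{-d} ∑_l κ_l C^{q,l,sym}_{μ,r}(K) r^{(d-l)+dq}`. -/
def symVolume (T : SelfSimilarSystem d N) (q : ℝ) (κ : Fin (d + 1) → ℝ) (r : ℝ) : ℝ :=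
  1 / r ^ d * ∑ l : Fin (d + 1), κ l * T.symCount q l r * r ^ (((d : ℝ) - (l : ℕ)) + d * q)

/-- `∑ᵢ pᵢ^q rᵢ^s` for complex `s`. -/
def cpressure (T : SelfSimilarSystem d N) (q : ℝ) (s : ℂ) : ℂ :=
  ∑ i, ((T.prob i ^ q : ℝ) : ℂ) * (T.ratio i : ℂ) ^ s

/-- The multifractal zeta function on `ℂ ∖ {s | ∑ᵢ pᵢ^q rᵢ^s = 1}` (at the excluded points the
value is the irrelevant `0` of division by zero). For `re s > β(q)` it is the sum of the series
`∑_𝐢 p_𝐢^q r_𝐢^s`, see `hasSum_zeta`. -/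
def zeta (T : SelfSimilarSystem d N) (q : ℝ) (s : ℂ) : ℂ :=
  T.cpressure q s / (1 - T.cpressure q s)

theorem norm_cpressure_lt_one (T : SelfSimilarSystem d N) {q : ℝ} {s : ℂ}
    (hs : T.beta q < s.re) : T.pressure q s.re < 1 ∧ ‖T.cpressure q s‖ < 1 := by
  have h1 : T.pressure q s.re < 1 := by
    rw [← T.pressure_beta q]; exact T.pressure_strictAnti q hs
  refine ⟨h1, lt_of_le_of_lt (norm_sum_le _ _) (lt_of_eq_of_lt ?_ h1)⟩
  refine Finset.sum_congr rfl fun i _ => ?_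
  rw [norm_mul, Complex.norm_cpow_eq_rpow_re_of_pos (T.ratio_pos i), Complex.norm_real,
    Real.norm_of_nonneg (Real.rpow_nonneg (T.prob_pos i).le _)]

/-- The zeta function is given by its defining series over all nonempty finite words in the
half-plane `re s > β(q)`. -/
theorem hasSum_zeta (T : SelfSimilarSystem d N) {q : ℝ} {s : ℂ} (hs : T.beta q < s.re) :
    HasSum (fun w : {w : List (Fin N) // w ≠ []} =>
      ((T.wordProb w ^ q : ℝ) : ℂ) * (T.wordRatio w : ℂ) ^ s) (T.zeta q s) := by
  obtain ⟨hre, hlt⟩ := T.norm_cpressure_lt_one hs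
  set a : Fin N → ℂ := fun i => ((T.prob i ^ q : ℝ) : ℂ) * (T.ratio i : ℂ) ^ s with ha
  have hterm : ∀ w : List (Fin N),
      ((T.wordProb w ^ q : ℝ) : ℂ) * (T.wordRatio w : ℂ) ^ s = (w.map a).prod := by
    intro w
    have hpos : 0 ≤ T.wordProb w ∧ 0 ≤ T.wordRatio w := by
      constructor
      · refine List.prod_nonneg fun x hx => ?_
        obtain ⟨i, _, rfl⟩ := List.mem_map.1 hx
        exact (T.prob_pos i).le
      · refine List.prod_nonneg fun x hx => ?_
        obtain ⟨i, _, rfl⟩ := List.mem_map.1 hx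
        exact (T.ratio_pos i).le
    induction w with
    | nil => simp [wordProb, wordRatio]
    | cons i w ih =>
      have hpos' : 0 ≤ T.wordProb w ∧ 0 ≤ T.wordRatio w := by
        constructor
        · refine List.prod_nonneg fun x hx => ?_
          obtain ⟨i, _, rfl⟩ := List.mem_map.1 hx
          exact (T.prob_pos i).le
        · refine List.prod_nonneg fun x hx => ?_
          obtain ⟨i, _, rfl⟩ := List.mem_map.1 hx
          exact (T.ratio_pos i).le
      have h1 : T.wordProb (i :: w) = T.prob i * T.wordProb w := by simp [wordProb]
      have h2 : T.wordRatio (i :: w) = T.ratio i * T.wordRatio w := by simp [wordRatio]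
      rw [h1, h2, Real.mul_rpow (T.prob_pos i).le hpos'.1, Complex.ofReal_mul, Complex.ofReal_mul,
        Complex.mul_cpow_ofReal_nonneg (T.ratio_pos i).le hpos'.2, List.map_cons, List.prod_cons,
        ← ih hpos', ha]
      ring
  have hsig : HasSum (fun x : (Σ n, Fin n → Fin N) => ∏ j, a (x.2 j))
      (1 - T.cpressure q s)⁻¹ := by
    have hnorm : ∀ i, ‖a i‖ = T.prob i ^ q * T.ratio i ^ s.re := by
      intro i
      rw [ha, norm_mul, Complex.norm_cpow_eq_rpow_re_of_pos (T.ratio_pos i), Complex.norm_real,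
        Real.norm_of_nonneg (Real.rpow_nonneg (T.prob_pos i).le _)]
    have hsum : Summable (fun x : (Σ n, Fin n → Fin N) => ∏ j, a (x.2 j)) := by
      refine Summable.of_norm ?_
      rw [summable_sigma_of_nonneg fun _ => norm_nonneg _]
      refine ⟨fun n => Summable.of_finite, ?_⟩
      have : ∀ n : ℕ, (∑' f : Fin n → Fin N, ‖∏ j, a (f j)‖) = T.pressure q s.re ^ n := by
        intro n
        rw [tsum_fintype]
        simp only [norm_prod, hnorm]
        rw [pressure, Fintype.sum_pow]
      simp only [this]
      refine summable_geometric_of_lt_one ?_ hre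
      exact Finset.sum_nonneg fun i _ =>
        mul_nonneg (Real.rpow_nonneg (T.prob_pos i).le _) (Real.rpow_nonneg (T.ratio_pos i).le _)
    have h2 := hsum.hasSum.sigma (g := fun n => T.cpressure q s ^ n) fun n => by
      have : T.cpressure q s ^ n = ∑ f : Fin n → Fin N, ∏ j, a (f j) := by
        rw [cpressure, Fintype.sum_pow]
      rw [this]
      exact hasSum_fintype _
    rw [← h2.unique (hasSum_geometric_of_norm_lt_one hlt)]
    exact hsum.hasSum
  have hlist : HasSum (fun w : List (Fin N) => (w.map a).prod) (1 - T.cpressure q s)⁻¹ := by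
    rw [← (List.equivSigmaTuple (α := Fin N)).symm.hasSum_iff]
    convert hsig using 2 with x
    simp [List.equivSigmaTuple, List.map_ofFn, List.prod_ofFn]
  have hne : (1 : ℂ) - T.cpressure q s ≠ 0 := by
    intro h
    rw [← sub_eq_zero.1 h] at hlt
    simp at hlt
  have hz : T.zeta q s = (1 - T.cpressure q s)⁻¹ - 1 := by
    rw [zeta]; field_simp; ring
  simp only [hterm]
  rw [hz]
  have := (hasSum_ite_eq ([] : List (Fin N)) (1 : ℂ))
  have h3 := hlist.sub this
  refine (Function.Injective.hasSum_iff Subtype.val_injective ?_).2 h3 |>.congr_fun ?_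
  · rintro w hw
    have hw' : w = [] := by
      by_contra hne'
      exact hw ⟨⟨w, hne'⟩, rfl⟩
    simp [hw']
  · rintro ⟨w, hw⟩
    simp [hw]

/-- The modified zeta function
`Z^q_μ(s) = (∑_l κ_l (σ_{q,l} - 1) / (s - (l - dq))) ζ^q_μ(s)`. -/
def modifiedZeta (T : SelfSimilarSystem d N) (q : ℝ) (κ : Fin (d + 1) → ℝ) (s : ℂ) : ℂ :=
  (∑ l : Fin (d + 1),
    ((κ l * (T.sigma q l - 1) : ℝ) : ℂ) / (s - (((l : ℕ) : ℂ) - d * q))) * T.zeta q s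

/-- A nondecreasing sequence of positive numbers `t_n → ∞` such that the horizontal lines
`Im s = ± t_n` avoid the singularities of the zeta function and, for each real `c`, the zeta
function is bounded on the half-lines `{σ ± i t_n | σ ≤ c}`, uniformly in `n`. -/
structure IsGrowthSequence (T : SelfSimilarSystem d N) (q : ℝ) (t : ℕ → ℝ) : Prop where
  monotone : Monotone t
  pos : ∀ n, 0 < t n
  tendsto : Tendsto t atTop atTop
  regular : ∀ (n : ℕ) (x : ℝ), T.cpressure q (x + t n * I) ≠ 1 ∧ T.cpressure q (x - t n * I) ≠ 1
  bounded : ∀ c : ℝ, ∃ k : ℝ, ∀ x : ℝ, x ≤ c → ∀ n : ℕ,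
    ‖T.zeta q (x + t n * I)‖ ≤ k ∧ ‖T.zeta q (x - t n * I)‖ ≤ k

end SelfSimilarSystem

/-- The set `P(f)` of poles of `f`. -/
def poles (f : ℂ → ℂ) : Set ℂ := {s | MeromorphicAt f s ∧ meromorphicOrderAt f s < 0}

/-- The residue of `f` at `ω`: the value, for all sufficiently small `ε > 0`, of
`(2πi)⁻¹ ∮_{|z - ω| = ε} f(z) dz`. -/
def residue (f : ℂ → ℂ) (ω : ℂ) : ℂ :=
  limUnder (𝓝[>] (0 : ℝ)) fun ε : ℝ => (2 * Real.pi * I)⁻¹ * ∮ z in C(ω, ε), f z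

end

/-! Put `e_l = l - dq` and `b_l = κ_l (σ_{q,l} - 1)`, so that `∑ b_l = 0`. Each non-empty word is a
child of exactly one word, and summing the weights of the children of `w` multiplies the weight of
`w` by `σ_{q,l}`. Hence, for `r < 1`, the boundary count becomes a sum over words of ratio larger
than `r`. The half-weighted words of ratio exactly `r` cancel by consistency (`symCount_eq`,
`symVolume_eq`), and `V(r) = ∑_{w ≠ ∅} p_w^q φ(r / r_w) + ∑_l κ_l σ_{q,l} r^{-e_l}`, where `φ(x) = ∑
b_l x^{-e_l}` on `(0, 1]` and `φ = 0` beyond.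

Since `∑ b_l = 0`, `φ` is continuous at `1`, and its Mellin transform `∑ b_l / (s - e_l)` decays
quadratically on vertical lines. Mellin inversion summed over words turns the first sum into `(1/2π)
∫ Z(c + iy) r^{-(c + iy)} dy` (`hasSum_integral_vertical`, `integral_vertical_eq`).

The line integral is evaluated by the residue theorem on the rectangles `[-(R + t_n), c] × [-t_n,
t_n]`. The residues are those at the poles of `ζ`, together with `b_l ζ(e_l) r^{-e_l} = -κ_l σ_{q,l}
r^{-e_l}` at the exponents, which cancel the second sum. The horizontal sides vanish like `1 / t_n`
by the growth condition, the left side like `t_n r^{t_n}`.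

Growth sequences come from recurrence: if `r_i^{in}` is near `1` for all `i`, the line at height `t₀
+ n` behaves like the line at height `t₀` (`exists_isGrowthSequence`). -/

noncomputable section

/-! ### Contour integrals along rectangles. -/

open Set intervalIntegral

/-- The integral of `f` along the positively oriented boundary of `[a, b] × [c, d]`. -/
def rectIntegral (f : ℂ → ℂ) (a b c d : ℝ) : ℂ :=
  (∫ x : ℝ in a..b, f (x + c * I)) - (∫ x : ℝ in a..b, f (x + d * I)) +
    I * (∫ y : ℝ in c..d, f (b + y * I)) - I * ∫ y : ℝ in c..d, f (a + y * I)

/-- The boundary of the rectangle `[a, b] × [c, d]`. -/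
def rectFrame (a b c d : ℝ) : Set ℂ := {z | z.re ∈ Icc a b ∧ z.im ∈ Icc c d ∧
  ¬(z.re ∈ Ioo a b ∧ z.im ∈ Ioo c d)}

section rectangle

variable {a b c d : ℝ} {f g : ℂ → ℂ}

theorem bottom_mem_rectFrame (hcd : c ≤ d) {x : ℝ} (hx : x ∈ Icc a b) :
    (x + c * I : ℂ) ∈ rectFrame a b c d := by
  simp_all [rectFrame]

theorem top_mem_rectFrame (hcd : c ≤ d) {x : ℝ} (hx : x ∈ Icc a b) :
    (x + d * I : ℂ) ∈ rectFrame a b c d := by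
  simp_all [rectFrame]

theorem right_mem_rectFrame (hab : a ≤ b) {y : ℝ} (hy : y ∈ Icc c d) :
    (b + y * I : ℂ) ∈ rectFrame a b c d := by
  simp_all [rectFrame]

theorem left_mem_rectFrame (hab : a ≤ b) {y : ℝ} (hy : y ∈ Icc c d) :
    (a + y * I : ℂ) ∈ rectFrame a b c d := by
  simp_all [rectFrame]

theorem rectIntegral_congr (hab : a ≤ b) (hcd : c ≤ d) (h : EqOn f g (rectFrame a b c d)) :
    rectIntegral f a b c d = rectIntegral g a b c d := by
  unfold rectIntegral
  congr 1; congr 1; congr 1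
  · exact integral_congr fun x hx => h (bottom_mem_rectFrame hcd (uIcc_of_le hab ▸ hx))
  · exact integral_congr fun x hx => h (top_mem_rectFrame hcd (uIcc_of_le hab ▸ hx))
  · congr 1
    exact integral_congr fun x hx => h (right_mem_rectFrame hab (uIcc_of_le hcd ▸ hx))
  · congr 1
    exact integral_congr fun x hx => h (left_mem_rectFrame hab (uIcc_of_le hcd ▸ hx))

theorem intervalIntegrable_bottom (hab : a ≤ b) (hcd : c ≤ d)
    (hf : ContinuousOn f (rectFrame a b c d)) :
    IntervalIntegrable (fun x : ℝ => f (x + c * I)) MeasureTheory.volume a b := by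
  refine ContinuousOn.intervalIntegrable (hf.comp (by fun_prop) fun x hx => ?_)
  exact bottom_mem_rectFrame hcd (uIcc_of_le hab ▸ hx)

theorem intervalIntegrable_top (hab : a ≤ b) (hcd : c ≤ d)
    (hf : ContinuousOn f (rectFrame a b c d)) :
    IntervalIntegrable (fun x : ℝ => f (x + d * I)) MeasureTheory.volume a b := by
  refine ContinuousOn.intervalIntegrable (hf.comp (by fun_prop) fun x hx => ?_)
  exact top_mem_rectFrame hcd (uIcc_of_le hab ▸ hx)

theorem intervalIntegrable_right (hab : a ≤ b) (hcd : c ≤ d)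
    (hf : ContinuousOn f (rectFrame a b c d)) :
    IntervalIntegrable (fun y : ℝ => f (b + y * I)) MeasureTheory.volume c d := by
  refine ContinuousOn.intervalIntegrable (hf.comp (by fun_prop) fun x hx => ?_)
  exact right_mem_rectFrame hab (uIcc_of_le hcd ▸ hx)

theorem intervalIntegrable_left (hab : a ≤ b) (hcd : c ≤ d)
    (hf : ContinuousOn f (rectFrame a b c d)) :
    IntervalIntegrable (fun y : ℝ => f (a + y * I)) MeasureTheory.volume c d := by
  refine ContinuousOn.intervalIntegrable (hf.comp (by fun_prop) fun x hx => ?_)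
  exact left_mem_rectFrame hab (uIcc_of_le hcd ▸ hx)

theorem rectIntegral_add (hab : a ≤ b) (hcd : c ≤ d) (hf : ContinuousOn f (rectFrame a b c d))
    (hg : ContinuousOn g (rectFrame a b c d)) :
    rectIntegral (fun z => f z + g z) a b c d =
      rectIntegral f a b c d + rectIntegral g a b c d := by
  unfold rectIntegral
  rw [integral_add (intervalIntegrable_bottom hab hcd hf) (intervalIntegrable_bottom hab hcd hg),
    integral_add (intervalIntegrable_top hab hcd hf) (intervalIntegrable_top hab hcd hg),
    integral_add (intervalIntegrable_right hab hcd hf) (intervalIntegrable_right hab hcd hg),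
    integral_add (intervalIntegrable_left hab hcd hf) (intervalIntegrable_left hab hcd hg)]
  ring

theorem rectIntegral_const_mul (k : ℂ) :
    rectIntegral (fun z => k * f z) a b c d = k * rectIntegral f a b c d := by
  unfold rectIntegral
  simp only [integral_const_mul]
  ring

theorem integral_horizontal_eq_sub {F : ℂ → ℂ} {y : ℝ}
    (hF : ∀ x ∈ uIcc a b, HasDerivAt F (f (x + y * I)) (x + y * I))
    (hf : ∀ x ∈ uIcc a b, ContinuousAt f (x + y * I)) :
    (∫ x : ℝ in a..b, f (x + y * I)) = F (b + y * I) - F (a + y * I) := by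
  refine integral_eq_sub_of_hasDerivAt (f := fun x : ℝ => F (x + y * I)) (fun x hx => ?_) ?_
  · have h1 : HasDerivAt (fun x : ℝ => (x + y * I : ℂ)) 1 x :=
      (Complex.ofRealCLM.hasDerivAt (x := x)).add_const (y * I : ℂ)
    exact ((hF x hx).comp x h1).congr_deriv (mul_one _)
  · refine ContinuousOn.intervalIntegrable fun x hx => ContinuousAt.continuousWithinAt ?_
    exact ContinuousAt.comp (f := fun x : ℝ => (x + y * I : ℂ)) (hf x hx) (by fun_prop)

theorem integral_vertical_eq_sub {F : ℂ → ℂ} {x : ℝ}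
    (hF : ∀ y ∈ uIcc c d, HasDerivAt F (f (x + (y : ℝ) * I)) (x + y * I))
    (hf : ∀ y ∈ uIcc c d, ContinuousAt f (x + (y : ℝ) * I)) :
    I * (∫ y : ℝ in c..d, f (x + y * I)) = F (x + d * I) - F (x + c * I) := by
  rw [← integral_const_mul]
  refine integral_eq_sub_of_hasDerivAt (f := fun y : ℝ => F (x + y * I)) (fun y hy => ?_) ?_
  · have h1 : HasDerivAt (fun y : ℝ => (x + y * I : ℂ)) I y := by
      simpa using ((Complex.ofRealCLM.hasDerivAt (x := y)).mul_const I).const_add (x : ℂ)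
    exact ((hF y hy).comp y h1).congr_deriv (mul_comm _ _)
  · refine ContinuousOn.intervalIntegrable fun y hy => ContinuousAt.continuousWithinAt ?_
    exact continuousAt_const.mul
      (ContinuousAt.comp (f := fun y : ℝ => (x + y * I : ℂ)) (hf y hy) (by fun_prop))

/-- A primitive is needed on the boundary only, so singularities inside are harmless. This disposes
of the polar parts of order at least two. -/
theorem rectIntegral_eq_zero_of_hasDerivAt (hab : a ≤ b) (hcd : c ≤ d) {F : ℂ → ℂ}
    (hF : ∀ z ∈ rectFrame a b c d, HasDerivAt F (f z) z)
    (hf : ∀ z ∈ rectFrame a b c d, ContinuousAt f z) : rectIntegral f a b c d = 0 := by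
  unfold rectIntegral
  rw [integral_horizontal_eq_sub (F := F) (y := c)
      (fun x hx => hF _ (bottom_mem_rectFrame hcd (uIcc_of_le hab ▸ hx)))
      (fun x hx => hf _ (bottom_mem_rectFrame hcd (uIcc_of_le hab ▸ hx))),
    integral_horizontal_eq_sub (F := F) (y := d)
      (fun x hx => hF _ (top_mem_rectFrame hcd (uIcc_of_le hab ▸ hx)))
      (fun x hx => hf _ (top_mem_rectFrame hcd (uIcc_of_le hab ▸ hx))),
    integral_vertical_eq_sub (F := F) (x := b)
      (fun x hx => hF _ (right_mem_rectFrame hab (uIcc_of_le hcd ▸ hx)))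
      (fun x hx => hf _ (right_mem_rectFrame hab (uIcc_of_le hcd ▸ hx))),
    integral_vertical_eq_sub (F := F) (x := a)
      (fun x hx => hF _ (left_mem_rectFrame hab (uIcc_of_le hcd ▸ hx)))
      (fun x hx => hf _ (left_mem_rectFrame hab (uIcc_of_le hcd ▸ hx)))]
  ring

/-- The primitive `log (z - ω)` serves on three sides, but the left side crosses its branch cut, and
`log (ω - z)` is used there. The two logarithms differ by `±πi` at the left corners, and these jumps
add up to `2πi`. -/
theorem rectIntegral_sub_inv {ω : ℂ} (hre : ω.re ∈ Ioo a b) (him : ω.im ∈ Ioo c d) :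
    rectIntegral (fun z => (z - ω)⁻¹) a b c d = 2 * Real.pi * I := by
  obtain ⟨h1, h2⟩ := hre
  obtain ⟨h3, h4⟩ := him
  have hd : ∀ z : ℂ, z - ω ∈ slitPlane →
      HasDerivAt (fun z => log (z - ω)) ((fun z => (z - ω)⁻¹) z) z := fun z hz => by
    simpa using ((hasDerivAt_id z).sub_const ω).clog hz
  have hd' : ∀ z : ℂ, ω - z ∈ slitPlane →
      HasDerivAt (fun z => log (ω - z)) ((fun z => (z - ω)⁻¹) z) z := fun z hz => by
    have h : HasDerivAt (fun z => ω - z) (-1) z := (hasDerivAt_id z).const_sub ω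
    have := h.clog hz
    rwa [neg_div, one_div, ← inv_neg, neg_sub] at this
  have hc : ∀ z : ℂ, z - ω ∈ slitPlane → ContinuousAt (fun z => (z - ω)⁻¹) z := fun z hz =>
    ContinuousAt.inv₀ (by fun_prop) (slitPlane_ne_zero hz)
  have hc' : ∀ z : ℂ, ω - z ∈ slitPlane → ContinuousAt (fun z => (z - ω)⁻¹) z := fun z hz =>
    ContinuousAt.inv₀ (by fun_prop) (by
      rw [← neg_ne_zero, neg_sub]; exact slitPlane_ne_zero hz)
  have hb : ∀ x ∈ uIcc a b, (x + c * I : ℂ) - ω ∈ slitPlane := fun x _ => by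
    refine Or.inr ?_
    simp; linarith
  have ht : ∀ x ∈ uIcc a b, (x + d * I : ℂ) - ω ∈ slitPlane := fun x _ => by
    refine Or.inr ?_
    simp; linarith
  have hr : ∀ y ∈ uIcc c d, (b + (y : ℝ) * I : ℂ) - ω ∈ slitPlane := fun x _ => by
    refine Or.inl ?_
    simp; linarith
  have hl : ∀ y ∈ uIcc c d, ω - (a + (y : ℝ) * I : ℂ) ∈ slitPlane := fun x _ => by
    refine Or.inl ?_
    simp; linarith
  unfold rectIntegral
  rw [integral_horizontal_eq_sub (fun x hx => hd _ (hb x hx)) (fun x hx => hc _ (hb x hx)),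
    integral_horizontal_eq_sub (fun x hx => hd _ (ht x hx)) (fun x hx => hc _ (ht x hx)),
    integral_vertical_eq_sub (fun x hx => hd _ (hr x hx)) (fun x hx => hc _ (hr x hx)),
    integral_vertical_eq_sub (fun x hx => hd' _ (hl x hx)) (fun x hx => hc' _ (hl x hx))]
  have e1 : log (ω - (a + d * I)) = log ((a + d * I) - ω) - Real.pi * I := by
    rw [← neg_sub (a + d * I : ℂ) ω, log, log, norm_neg,
      arg_neg_eq_arg_sub_pi_of_im_pos (by simp; linarith)]
    push_cast; ring
  have e2 : log (ω - (a + c * I)) = log ((a + c * I) - ω) + Real.pi * I := by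
    rw [← neg_sub (a + c * I : ℂ) ω, log, log, norm_neg,
      arg_neg_eq_arg_add_pi_of_im_neg (by simp; linarith)]
    push_cast; ring
  rw [e1, e2]
  ring

theorem rectIntegral_eq_zero_of_differentiable (hab : a ≤ b) (hcd : c ≤ d)
    (hf : ∀ z : ℂ, z.re ∈ Icc a b → z.im ∈ Icc c d → DifferentiableAt ℂ f z) :
    rectIntegral f a b c d = 0 := by
  have := integral_boundary_rect_eq_zero_of_differentiableOn f (a + c * I) (b + d * I) (by
    rintro z ⟨h1, h2⟩
    simp [uIcc_of_le, hab, hcd] at h1 h2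
    exact (hf z h1 h2).differentiableWithinAt)
  simpa [rectIntegral] using this

end rectangle

/-! ### Residues and the residue theorem for rectangles. -/

/-- `f` has an isolated singularity at `ω` with residue `k`: near `ω` it is the sum of
`k / (z - ω)`, of the derivative of a function on `ℂ ∖ {ω}`, and of an analytic function. -/
def HasResidue (f : ℂ → ℂ) (ω k : ℂ) : Prop :=
  ∃ Q Q' h : ℂ → ℂ, (∀ z, z ≠ ω → HasDerivAt Q (Q' z) z) ∧
    (∀ z, z ≠ ω → DifferentiableAt ℂ Q' z) ∧ AnalyticAt ℂ h ω ∧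
    ∀ᶠ z in 𝓝[≠] ω, f z = k * (z - ω)⁻¹ + Q' z + h z

theorem HasResidue.congr {f g : ℂ → ℂ} {ω k : ℂ} (hf : HasResidue f ω k)
    (h : g =ᶠ[𝓝[≠] ω] f) : HasResidue g ω k := by
  obtain ⟨Q, Q', u, h1, h2, h3, h4⟩ := hf
  exact ⟨Q, Q', u, h1, h2, h3, h.trans h4⟩

theorem HasResidue.sub_analyticAt {f g : ℂ → ℂ} {ω k : ℂ} (hf : HasResidue f ω k)
    (hg : AnalyticAt ℂ g ω) : HasResidue (fun z => f z - g z) ω k := by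
  obtain ⟨Q, Q', u, h1, h2, h3, h4⟩ := hf
  refine ⟨Q, Q', fun z => u z - g z, h1, h2, h3.sub hg, ?_⟩
  filter_upwards [h4] with z hz
  rw [hz]; ring

theorem AnalyticAt.dslope_self {g : ℂ → ℂ} {ω : ℂ} (hg : AnalyticAt ℂ g ω) :
    AnalyticAt ℂ (dslope g ω) ω := by
  obtain ⟨p, hp⟩ := hg
  exact hp.has_fpower_series_dslope_fslope.analyticAt

/-- Writing `g z = g ω + (z - ω) * dslope g ω z` splits off the leading polar term and lowers the
order of the rest by one. -/
theorem AnalyticAt.exists_hasResidue_zpow_mul {g : ℂ → ℂ} {ω : ℂ} (hg : AnalyticAt ℂ g ω) (n : ℕ) :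
    ∃ k, HasResidue (fun z => (z - ω) ^ (-n : ℤ) * g z) ω k := by
  induction n generalizing g with
  | zero =>
    refine ⟨0, fun _ => 0, fun _ => 0, g, fun z _ => hasDerivAt_const _ _,
      fun z _ => differentiableAt_const _, hg, Eventually.of_forall fun z => by simp⟩
  | succ n ih =>
    obtain ⟨k, Q, Q', h, h1, h2, h3, h4⟩ := ih hg.dslope_self
    have key : ∀ z, z ≠ ω → (z - ω) ^ (-(n + 1 : ℕ) : ℤ) * g z =
        g ω * (z - ω) ^ (-(n + 1 : ℕ) : ℤ) + (z - ω) ^ (-n : ℤ) * dslope g ω z := by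
      intro z hz
      have hz' := sub_ne_zero.2 hz
      have : g z = g ω + (z - ω) * dslope g ω z := by
        rw [← smul_eq_mul, sub_smul_dslope]; ring
      have e : (z - ω) ^ (-n : ℤ) = (z - ω) ^ (-(n + 1 : ℕ) : ℤ) * (z - ω) := by
        rw [← zpow_add_one₀ hz']; congr 1; push_cast; ring
      rw [this, e]; ring
    -- Only the power `-1` has no single-valued primitive: for `n = 0` the coefficient `g ω` joins
    -- the residue, otherwise the term joins `Q'`.
    rcases Nat.eq_zero_or_pos n with rfl | hn
    · refine ⟨k + g ω, Q, Q', h, h1, h2, h3, ?_⟩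
      filter_upwards [h4, self_mem_nhdsWithin] with z hz hzω
      rw [key z hzω, hz]
      simp; ring
    · have hn' : (n : ℂ) ≠ 0 := Nat.cast_ne_zero.2 hn.ne'
      have hdz : ∀ z, z ≠ ω → HasDerivAt (fun z => g ω * (-n : ℂ)⁻¹ * (z - ω) ^ (-n : ℤ))
          (g ω * (z - ω) ^ (-(n + 1 : ℕ) : ℤ)) z := by
        intro z hz
        have := ((hasDerivAt_zpow (-n : ℤ) (z - ω) (Or.inl (sub_ne_zero.2 hz))).comp z
          ((hasDerivAt_id z).sub_const ω)).const_mul (g ω * (-n : ℂ)⁻¹)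
        refine this.congr_deriv ?_
        rw [show (-(n : ℤ) - 1) = (-(n + 1 : ℕ) : ℤ) by push_cast; ring]
        push_cast
        field_simp
      refine ⟨k, fun z => Q z + g ω * (-n : ℂ)⁻¹ * (z - ω) ^ (-n : ℤ),
        fun z => Q' z + g ω * (z - ω) ^ (-(n + 1 : ℕ) : ℤ), h,
        fun z hz => (h1 z hz).add (hdz z hz), fun z hz => (h2 z hz).add ?_, h3, ?_⟩
      · refine DifferentiableAt.const_mul (DifferentiableAt.zpow (by fun_prop) ?_) _
        exact Or.inl (sub_ne_zero.2 hz)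
      · filter_upwards [h4, self_mem_nhdsWithin] with z hz hzω
        rw [key z hzω, hz]
        ring

theorem MeromorphicAt.exists_hasResidue {f : ℂ → ℂ} {ω : ℂ} (hf : MeromorphicAt f ω) :
    ∃ k, HasResidue f ω k := by
  obtain ⟨n, hn⟩ := hf
  obtain ⟨k, hk⟩ := hn.exists_hasResidue_zpow_mul n
  refine ⟨k, hk.congr ?_⟩
  filter_upwards [self_mem_nhdsWithin] with z hz
  have := sub_ne_zero.2 hz
  simp [this]

/-- On every small circle `Q'` integrates to zero because it has a primitive, and `h` by Cauchy's
theorem. The expression under the limit is therefore eventually constant. -/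
theorem HasResidue.residue_eq {f : ℂ → ℂ} {ω k : ℂ} (hf : HasResidue f ω k) :
    residue f ω = k := by
  obtain ⟨Q, Q', h, h1, h2, h3, h4⟩ := hf
  refine Tendsto.limUnder_eq (tendsto_const_nhds.congr' ?_)
  have h5 := h3.eventually_analyticAt
  obtain ⟨δ, hδ, hball⟩ := Metric.eventually_nhds_iff.1 (h5.and (eventually_nhdsWithin_iff.1 h4))
  filter_upwards [Ioo_mem_nhdsGT hδ] with ε hε
  have hεδ : ∀ z ∈ Metric.closedBall ω ε, dist z ω < δ := fun z hz => lt_of_le_of_lt hz hε.2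
  have hsub : Metric.sphere ω ε ⊆ Metric.closedBall ω ε := Metric.sphere_subset_closedBall
  have hne : ∀ z ∈ Metric.sphere ω ε, z ≠ ω := by
    rintro z hz rfl
    simp at hz
    exact hε.1.ne hz
  have e1 : (∮ z in C(ω, ε), f z) = ∮ z in C(ω, ε), (k * (z - ω)⁻¹ + Q' z + h z) :=
    circleIntegral.integral_congr hε.1.le fun z hz => (hball (hεδ z (hsub hz))).2 (hne z hz)
  have c1 : ContinuousOn (fun z => k * (z - ω)⁻¹) (Metric.sphere ω ε) := by
    refine continuousOn_const.mul (ContinuousOn.inv₀ (by fun_prop) fun z hz => ?_)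
    exact sub_ne_zero.2 (hne z hz)
  have c2 : ContinuousOn Q' (Metric.sphere ω ε) := fun z hz =>
    (h2 z (hne z hz)).continuousAt.continuousWithinAt
  have c3 : ContinuousOn h (Metric.closedBall ω ε) := fun z hz =>
    (hball (hεδ z hz)).1.continuousAt.continuousWithinAt
  have e2 : (∮ z in C(ω, ε), h z) = 0 :=
    circleIntegral_eq_zero_of_differentiable_on_off_countable hε.1.le countable_empty c3
      fun z hz => (hball (hεδ z (Metric.ball_subset_closedBall hz.1))).1.differentiableAt
  have e3 : (∮ z in C(ω, ε), Q' z) = 0 :=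
    circleIntegral.integral_eq_zero_of_hasDerivWithinAt hε.1.le fun z hz =>
      (h1 z (hne z hz)).hasDerivWithinAt
  have c12 : ContinuousOn (fun z => k * (z - ω)⁻¹ + Q' z) (Metric.sphere ω ε) := c1.add c2
  rw [e1, circleIntegral.integral_add (c12.circleIntegrable hε.1.le)
    ((c3.mono hsub).circleIntegrable hε.1.le), circleIntegral.integral_add
    (c1.circleIntegrable hε.1.le) (c2.circleIntegrable hε.1.le), e2, e3,
    circleIntegral.integral_const_mul, circleIntegral.integral_sub_center_inv ω hε.1.ne']
  have : (2 * Real.pi * I : ℂ) ≠ 0 := by simp [Real.pi_ne_zero]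
  field_simp
  ring

/-- The residue theorem for rectangles. -/
theorem rectIntegral_eq_sum_residue {a b c d : ℝ} (hab : a ≤ b) (hcd : c ≤ d) (S : Finset ℂ)
    (k : ℂ → ℂ) (f : ℂ → ℂ) (hS : ∀ ω ∈ S, ω.re ∈ Ioo a b ∧ ω.im ∈ Ioo c d)
    (hk : ∀ ω ∈ S, HasResidue f ω (k ω))
    (hf : ∀ z : ℂ, z.re ∈ Icc a b → z.im ∈ Icc c d → z ∉ S → DifferentiableAt ℂ f z) :
    rectIntegral f a b c d = 2 * Real.pi * I * ∑ ω ∈ S, k ω := by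
  classical
  induction S using Finset.induction_on generalizing f with
  | empty =>
    rw [rectIntegral_eq_zero_of_differentiable hab hcd fun z h1 h2 => hf z h1 h2 (by simp)]
    simp
  | insert ω S hω ih =>
    obtain ⟨Q, Q', h, h1, h2, h3, h4⟩ := hk ω (Finset.mem_insert_self _ _)
    have hint := hS ω (Finset.mem_insert_self _ _)
    set P : ℂ → ℂ := fun z => k ω * (z - ω)⁻¹ + Q' z with hP
    have hPd : ∀ z, z ≠ ω → DifferentiableAt ℂ P z := fun z hz =>
      (DifferentiableAt.const_mul (DifferentiableAt.fun_inv (differentiableAt_id.sub_const ω)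
        (sub_ne_zero.2 hz)) _).add (h2 z hz)
    have hPa : ∀ z, z ≠ ω → AnalyticAt ℂ P z := fun z hz =>
      DifferentiableOn.analyticAt (s := {ω}ᶜ)
        (fun y hy => (hPd y hy).differentiableWithinAt) (isOpen_compl_singleton.mem_nhds hz)
    -- Removing the polar part `P` and filling in the value `h ω` makes `g` holomorphic at `ω`, so
    -- the induction hypothesis for `S` applies to `g`.
    set g : ℂ → ℂ := Function.update (fun z => f z - P z) ω (h ω) with hg
    have hgne : ∀ z, z ≠ ω → g =ᶠ[𝓝 z] fun z => f z - P z := fun z hz => by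
      filter_upwards [isOpen_ne.mem_nhds hz] with y hy
      exact Function.update_of_ne hy _ _
    have hgω : g =ᶠ[𝓝 ω] h := by
      filter_upwards [eventually_nhdsWithin_iff.1 h4] with y hy
      by_cases hyω : y = ω
      · rw [hyω, hg, Function.update_self]
      · rw [hg, Function.update_of_ne hyω, hy hyω, hP]; ring
    have hne : ∀ s ∈ S, s ≠ ω := fun s hs h => hω (h ▸ hs)
    have hgint := ih g (fun s hs => hS s (Finset.mem_insert_of_mem hs))
      (fun s hs => ((hk s (Finset.mem_insert_of_mem hs)).sub_analyticAt (hPa s (hne s hs))).congr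
        ((hgne s (hne s hs)).filter_mono nhdsWithin_le_nhds))
      (fun z hz1 hz2 hzS => by
        by_cases hzω : z = ω
        · subst hzω; exact h3.differentiableAt.congr_of_eventuallyEq hgω
        · exact ((hf z hz1 hz2 (by simp [hzω, hzS])).sub (hPd z hzω)).congr_of_eventuallyEq
            (hgne z hzω))
    have hfr : ∀ z ∈ rectFrame a b c d, z ∉ insert ω S := fun z hz hzS => hz.2.2 (hS z hzS)
    have hfrω : ∀ z ∈ rectFrame a b c d, z ≠ ω := fun z hz h =>
      hfr z hz (h ▸ Finset.mem_insert_self _ _)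
    have cP : ContinuousOn P (rectFrame a b c d) := fun z hz =>
      (hPd z (hfrω z hz)).continuousAt.continuousWithinAt
    have cf : ContinuousOn f (rectFrame a b c d) := fun z hz =>
      (hf z hz.1 hz.2.1 (hfr z hz)).continuousAt.continuousWithinAt
    have cg : ContinuousOn g (rectFrame a b c d) := (cf.sub cP).congr fun z hz =>
      (hgne z (hfrω z hz)).eq_of_nhds
    have cinv : ContinuousOn (fun z => k ω * (z - ω)⁻¹) (rectFrame a b c d) := by
      refine continuousOn_const.mul (ContinuousOn.inv₀ (by fun_prop) fun z hz => ?_)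
      exact sub_ne_zero.2 (hfrω z hz)
    have cQ : ContinuousOn Q' (rectFrame a b c d) := fun z hz =>
      (h2 z (hfrω z hz)).continuousAt.continuousWithinAt
    rw [rectIntegral_congr hab hcd (g := fun z => g z + P z) fun z hz => by
        simp [(hgne z (hfrω z hz)).eq_of_nhds],
      rectIntegral_add hab hcd cg cP, hgint, hP, rectIntegral_add hab hcd cinv cQ,
      rectIntegral_const_mul, rectIntegral_sub_inv hint.1 hint.2,
      rectIntegral_eq_zero_of_hasDerivAt hab hcd (fun z hz => h1 z (hfrω z hz))
        (fun z hz => (h2 z (hfrω z hz)).continuousAt), Finset.sum_insert hω]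
    ring

end

/-! ### Poles of the zeta function and existence of growth sequences. -/

noncomputable section

namespace SelfSimilarSystem

variable {d N : ℕ} (T : SelfSimilarSystem d N) (q : ℝ)

theorem pressure_term_pos (i : Fin N) (t : ℝ) : 0 < T.prob i ^ q * T.ratio i ^ t :=
  mul_pos (Real.rpow_pos_of_pos (T.prob_pos i) _) (Real.rpow_pos_of_pos (T.ratio_pos i) _)

theorem pressure_pos (t : ℝ) : 0 < T.pressure q t := by
  have := T.nonempty_index
  exact Finset.sum_pos (fun i _ => T.pressure_term_pos q i t) Finset.univ_nonempty

theorem norm_cpressure_term (i : Fin N) (s : ℂ) :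
    ‖((T.prob i ^ q : ℝ) : ℂ) * (T.ratio i : ℂ) ^ s‖ = T.prob i ^ q * T.ratio i ^ s.re := by
  rw [norm_mul, Complex.norm_cpow_eq_rpow_re_of_pos (T.ratio_pos i), Complex.norm_real,
    Real.norm_of_nonneg (Real.rpow_nonneg (T.prob_pos i).le _)]

theorem norm_cpressure_le (s : ℂ) : ‖T.cpressure q s‖ ≤ T.pressure q s.re :=
  (norm_sum_le _ _).trans_eq (Finset.sum_congr rfl fun i _ => T.norm_cpressure_term q i s)

theorem cpressure_ofReal (t : ℝ) : T.cpressure q t = T.pressure q t := by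
  simp only [cpressure, pressure, ofReal_sum, ofReal_mul, ofReal_cpow (T.ratio_pos _).le]

theorem differentiable_cpressure : Differentiable ℂ (T.cpressure q) := by
  refine Differentiable.fun_sum fun i _ => (Differentiable.const_mul ?_ _)
  exact fun s => (differentiableAt_id).const_cpow (Or.inl (ofReal_ne_zero.2 (T.ratio_pos i).ne'))

theorem cpressure_conj (s : ℂ) :
    T.cpressure q ((starRingEnd ℂ) s) = (starRingEnd ℂ) (T.cpressure q s) := by
  simp only [cpressure, map_sum, map_mul, conj_ofReal]
  refine Finset.sum_congr rfl fun i _ => ?_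
  rw [cpow_conj _ _ (by simp [arg_ofReal_of_nonneg (T.ratio_pos i).le, Real.pi_ne_zero.symm]),
    conj_ofReal]

theorem zeta_conj (s : ℂ) : T.zeta q ((starRingEnd ℂ) s) = (starRingEnd ℂ) (T.zeta q s) := by
  simp only [zeta, cpressure_conj, map_div₀, map_sub, map_one]

theorem cpressure_ne_one_of_beta_lt {s : ℂ} (hs : T.beta q < s.re) : T.cpressure q s ≠ 1 := by
  intro h
  have := (T.norm_cpressure_lt_one hs).2
  simp [h] at this

/-- Far to the left the terms with minimal ratio dominate, so `∑ᵢ pᵢ^q rᵢ^s` is large there. -/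
theorem exists_two_le_norm_cpressure :
    ∃ x₀ : ℝ, ∀ s : ℂ, s.re ≤ x₀ → 2 ≤ ‖T.cpressure q s‖ := by
  have := T.nonempty_index
  obtain ⟨j, hj⟩ := Finite.exists_min T.ratio
  set m := T.ratio j with hm
  have hm0 : 0 < m := T.ratio_pos j
  set A := ∑ i with T.ratio i = m, T.prob i ^ q with hA
  have hA0 : 0 < A := Finset.sum_pos (fun i _ => Real.rpow_pos_of_pos (T.prob_pos i) _)
    ⟨j, by simp [hm]⟩
  -- With `m ^ x` factored out, the remaining bases `T.ratio i / m` exceed `1`, so their powers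
  -- vanish as `x → -∞`.
  have hlim : Tendsto (fun x : ℝ => m ^ x *
      (A - ∑ i with ¬ T.ratio i = m, T.prob i ^ q * (T.ratio i / m) ^ x)) atBot atTop := by
    refine Tendsto.atTop_mul_pos (C := A - ∑ i with ¬ T.ratio i = m, T.prob i ^ q * 0)
      (by simpa using hA0)
      (tendsto_rpow_atBot_of_base_lt_one _ hm0 (T.ratio_lt_one j)) ?_
    refine tendsto_const_nhds.sub (tendsto_finsetSum _ fun i hi => Tendsto.const_mul _ ?_)
    refine tendsto_rpow_atBot_of_base_gt_one _ ?_
    rw [one_lt_div hm0]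
    exact lt_of_le_of_ne (hj i) (Ne.symm (Finset.mem_filter.1 hi).2)
  obtain ⟨x₀, hx₀⟩ := eventually_atBot.1 (hlim.eventually_ge_atTop 2)
  refine ⟨x₀, fun s hs => (hx₀ s.re hs).trans ?_⟩
  have hsplit : T.cpressure q s = (A : ℂ) * (m : ℂ) ^ s +
      ∑ i with ¬ T.ratio i = m, ((T.prob i ^ q : ℝ) : ℂ) * (T.ratio i : ℂ) ^ s := by
    rw [cpressure, ← Finset.sum_filter_add_sum_filter_not _ (fun i => T.ratio i = m), hA,
      ofReal_sum, Finset.sum_mul]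
    congr 1
    exact Finset.sum_congr rfl fun i hi => by rw [(Finset.mem_filter.1 hi).2]
  have h1 : ‖(A : ℂ) * (m : ℂ) ^ s‖ = A * m ^ s.re := by
    rw [norm_mul, norm_cpow_eq_rpow_re_of_pos hm0, norm_real, Real.norm_of_nonneg hA0.le]
  have h2 : ‖∑ i with ¬ T.ratio i = m, ((T.prob i ^ q : ℝ) : ℂ) * (T.ratio i : ℂ) ^ s‖ ≤
      m ^ s.re * ∑ i with ¬ T.ratio i = m, T.prob i ^ q * (T.ratio i / m) ^ s.re := by
    refine (norm_sum_le _ _).trans_eq ?_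
    rw [Finset.mul_sum]
    refine Finset.sum_congr rfl fun i _ => ?_
    rw [T.norm_cpressure_term, Real.div_rpow (T.ratio_pos i).le hm0.le]
    have := (Real.rpow_pos_of_pos hm0 s.re).ne'
    field_simp
  have h3 := norm_sub_norm_le ((A : ℂ) * (m : ℂ) ^ s)
    (-∑ i with ¬ T.ratio i = m, ((T.prob i ^ q : ℝ) : ℂ) * (T.ratio i : ℂ) ^ s)
  rw [sub_neg_eq_add, norm_neg, ← hsplit, h1] at h3
  rw [mul_sub]
  linarith [mul_comm A (m ^ s.re)]

theorem cpressure_ne_one_of_two_le {s : ℂ} (hs : 2 ≤ ‖T.cpressure q s‖) :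
    T.cpressure q s ≠ 1 := by
  intro h
  rw [h] at hs
  norm_num at hs

theorem half_norm_le_norm_one_sub {z : ℂ} (hz : 2 ≤ ‖z‖) : ‖z‖ / 2 ≤ ‖1 - z‖ := by
  have := norm_sub_norm_le z 1
  rw [norm_sub_rev, norm_one] at this
  linarith

theorem norm_zeta_le_two {s : ℂ} (hs : 2 ≤ ‖T.cpressure q s‖) : ‖T.zeta q s‖ ≤ 2 := by
  have := half_norm_le_norm_one_sub hs
  rw [zeta, norm_div, div_le_iff₀ (by linarith)]
  linarith

theorem analyticAt_cpressure (s : ℂ) : AnalyticAt ℂ (T.cpressure q) s :=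
  (T.differentiable_cpressure q).analyticAt s

theorem analyticAt_zeta {s : ℂ} (hs : T.cpressure q s ≠ 1) : AnalyticAt ℂ (T.zeta q) s :=
  (T.analyticAt_cpressure q s).div (analyticAt_const.sub (T.analyticAt_cpressure q s))
    (sub_ne_zero.2 hs.symm)

theorem meromorphicAt_zeta (s : ℂ) : MeromorphicAt (T.zeta q) s :=
  (T.analyticAt_cpressure q s).meromorphicAt.div
    (analyticAt_const.sub (T.analyticAt_cpressure q s)).meromorphicAt

/-- The entire function `1 - T.cpressure q` does not vanish to the right of `β(q)`, so by the
identity theorem its zeros are isolated. -/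
theorem compl_cpressure_eq_one_mem_codiscrete :
    {s : ℂ | T.cpressure q s = 1}ᶜ ∈ codiscrete ℂ := by
  have h := AnalyticOnNhd.preimage_zero_mem_codiscrete (f := fun s => 1 - T.cpressure q s)
    (x := ((T.beta q + 1 : ℝ) : ℂ)) (fun s _ => analyticAt_const.sub (T.analyticAt_cpressure q s))
    (sub_ne_zero.2 (T.cpressure_ne_one_of_beta_lt q (by simp)).symm)
  convert h using 1
  ext s
  simp [sub_eq_zero (a := (1 : ℂ)), eq_comm (a := (1 : ℂ))]

/-- Where the denominator vanishes the numerator equals `1`, so no zero of the denominator is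
cancelled. -/
theorem poles_zeta : poles (T.zeta q) = {s | T.cpressure q s = 1} := by
  ext ω
  simp only [poles, Set.mem_ofPred_eq]
  constructor
  · rintro ⟨_, h⟩
    by_contra hω
    exact absurd h (not_lt.2 (T.analyticAt_zeta q hω).meromorphicOrderAt_nonneg)
  · intro hω
    refine ⟨T.meromorphicAt_zeta q ω, ?_⟩
    rw [← tendsto_cobounded_iff_meromorphicOrderAt_neg (T.meromorphicAt_zeta q ω),
      ← tendsto_norm_atTop_iff_cobounded]
    have hc : Tendsto (T.cpressure q) (𝓝[≠] ω) (𝓝 1) := by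
      rw [← hω]
      exact (T.differentiable_cpressure q).continuous.continuousAt.mono_left nhdsWithin_le_nhds
    have hne : ∀ᶠ s in 𝓝[≠] ω, 1 - T.cpressure q s ≠ 0 := by
      have := mem_codiscrete.1 (T.compl_cpressure_eq_one_mem_codiscrete q) ω
      rw [compl_compl, disjoint_principal_right] at this
      filter_upwards [this] with s hs h
      exact hs (sub_eq_zero.1 h).symm
    have h0 : Tendsto (fun s => 1 - T.cpressure q s) (𝓝[≠] ω) (𝓝[≠] 0) := by
      refine tendsto_nhdsWithin_iff.2 ⟨?_, hne⟩
      simpa using (tendsto_const_nhds (x := (1 : ℂ))).sub hc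
    have h1 := tendsto_norm_atTop_iff_cobounded.2 (tendsto_inv₀_nhdsNE_zero.comp h0)
    refine (Tendsto.pos_mul_atTop (by simp) hc.norm h1).congr fun s => ?_
    simp [zeta, div_eq_mul_inv]

/-- All solutions have real part between `x₀` and `β(q)`; a closed discrete set meets the resulting
compact rectangle in finitely many points. -/
theorem finite_cpressure_eq_one_of_abs_im_le (τ : ℝ) :
    {ω : ℂ | T.cpressure q ω = 1 ∧ |ω.im| ≤ τ}.Finite := by
  obtain ⟨x₀, hx₀⟩ := T.exists_two_le_norm_cpressure q
  have hcl := mem_codiscrete'.1 (T.compl_cpressure_eq_one_mem_codiscrete q)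
  rw [compl_compl] at hcl
  have hK : IsCompact (Set.Icc x₀ (T.beta q) ×ℂ Set.Icc (-τ) τ) :=
    isCompact_Icc.reProdIm isCompact_Icc
  have hclosed : IsClosed {s : ℂ | T.cpressure q s = 1} :=
    isClosed_eq (T.differentiable_cpressure q).continuous continuous_const
  refine ((hK.inter_right hclosed).finite (hcl.2.mono Set.inter_subset_right)).subset ?_
  rintro ω ⟨h1, h2⟩
  refine ⟨⟨⟨?_, ?_⟩, abs_le.1 h2⟩, h1⟩
  · by_contra h
    exact T.cpressure_ne_one_of_two_le q (hx₀ ω (not_le.1 h).le) h1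
  · by_contra h
    exact T.cpressure_ne_one_of_beta_lt q (not_le.1 h) h1

/-- Simultaneous recurrence of the functions `y ↦ rᵢ^{iy}`. -/
theorem exists_nat_norm_cpow_sub_one_le {ε : ℝ} (hε : 0 < ε) (M : ℕ) :
    ∃ n ≥ M, ∀ i, ‖(T.ratio i : ℂ) ^ ((n : ℂ) * I) - 1‖ ≤ ε := by
  set u : ℕ → Fin N → ℂ := fun n i => (T.ratio i : ℂ) ^ ((n : ℂ) * I) with hu
  have hnorm : ∀ n i, ‖u n i‖ = 1 := fun n i => by
    rw [hu, norm_cpow_eq_rpow_re_of_pos (T.ratio_pos i)]; simp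
  have hmem : ∀ n, u n ∈ Metric.closedBall (0 : Fin N → ℂ) 1 := fun n => by
    rw [mem_closedBall_zero_iff, pi_norm_le_iff_of_nonneg zero_le_one]
    exact fun i => (hnorm n i).le
  obtain ⟨v, _, φ, hφ, hv⟩ := tendsto_subseq_of_bounded Metric.isBounded_closedBall hmem
  obtain ⟨K, hK⟩ := Metric.cauchySeq_iff'.1 hv.cauchySeq ε hε
  -- The index is large enough that `φ (φ K + M + K) - φ K ≥ M`, because `φ n ≥ n`. Two nearby terms
  -- of the convergent subsequence differ by the wanted shift.
  have hge : K ≤ φ K + M + K := by omega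
  have hφle := hφ.id_le (φ K + M + K)
  simp only [id] at hφle
  refine ⟨φ (φ K + M + K) - φ K, by omega, fun i => ?_⟩
  have h1 := (hK (φ K + M + K) hge).le
  rw [dist_pi_le_iff hε.le] at h1
  have h2 := h1 i
  rw [dist_eq_norm] at h2
  have hr : (T.ratio i : ℂ) ≠ 0 := ofReal_ne_zero.2 (T.ratio_pos i).ne'
  have h3 : u (φ (φ K + M + K)) i - u (φ K) i =
      u (φ K) i * ((T.ratio i : ℂ) ^ (((φ (φ K + M + K) - φ K : ℕ) : ℂ) * I) - 1) := by
    rw [mul_sub, mul_one, hu]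
    simp only
    rw [← cpow_add _ _ hr, ← add_mul, ← Nat.cast_add, Nat.add_sub_cancel' (by omega)]
  simp only [Function.comp] at h2
  rw [h3, norm_mul, hnorm, one_mul] at h2
  exact h2

theorem exists_pos_forall_cpressure_ne_one :
    ∃ t₀ : ℝ, 0 < t₀ ∧ ∀ x : ℝ, T.cpressure q (x + t₀ * I) ≠ 1 := by
  have hfin := (T.finite_cpressure_eq_one_of_abs_im_le q 1).image Complex.im
  obtain ⟨t₀, ht, hnot⟩ := (Set.Ioo_infinite (zero_lt_one (α := ℝ))).exists_notMem_finite hfin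
  refine ⟨t₀, ht.1, fun x h => hnot ⟨x + t₀ * I, ⟨h, ?_⟩, by simp⟩⟩
  simp [abs_of_pos ht.1, ht.2.le]

/-- Compactness gives a lower bound on the middle segment. To its left the sum has modulus at least
`2`; to its right the modulus is at most the pressure at `β(q) + 1`, which is less than `1`. -/
theorem exists_pos_le_norm_one_sub_cpressure {t₀ : ℝ}
    (ht₀ : ∀ x : ℝ, T.cpressure q (x + t₀ * I) ≠ 1) :
    ∃ δ > 0, ∀ x : ℝ, δ ≤ ‖1 - T.cpressure q (x + t₀ * I)‖ := by
  obtain ⟨x₀, hx₀⟩ := T.exists_two_le_norm_cpressure q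
  have hcont : Continuous fun x : ℝ => ‖1 - T.cpressure q (x + t₀ * I)‖ :=
    (continuous_const.sub ((T.differentiable_cpressure q).continuous.comp (by fun_prop))).norm
  have hpos : ∀ x : ℝ, 0 < ‖1 - T.cpressure q (x + t₀ * I)‖ := fun x =>
    norm_pos_iff.2 (sub_ne_zero.2 (ht₀ x).symm)
  have hmid : ∃ δ > 0, ∀ x ∈ Set.Icc x₀ (T.beta q + 1),
      δ ≤ ‖1 - T.cpressure q (x + t₀ * I)‖ := by
    rcases (Set.Icc x₀ (T.beta q + 1)).eq_empty_or_nonempty with h | h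
    · exact ⟨1, one_pos, by simp [h]⟩
    · obtain ⟨y, _, hy⟩ := isCompact_Icc.exists_isMinOn h hcont.continuousOn
      exact ⟨_, hpos y, fun x hx => hy hx⟩
  obtain ⟨δ, hδ, hδ'⟩ := hmid
  have hβ : T.pressure q (T.beta q + 1) < 1 :=
    (T.pressure_strictAnti q (lt_add_one _)).trans_eq (T.pressure_beta q)
  refine ⟨min δ (min 1 (1 - T.pressure q (T.beta q + 1))),
    lt_min hδ (lt_min one_pos (by linarith)), fun x => ?_⟩
  rcases le_total x x₀ with h | h
  · have h2 := hx₀ (x + t₀ * I) (by simpa using h)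
    have := half_norm_le_norm_one_sub h2
    exact (min_le_right _ _).trans ((min_le_left _ _).trans (by linarith))
  rcases le_total x (T.beta q + 1) with h' | h'
  · exact (min_le_left _ _).trans (hδ' x ⟨h, h'⟩)
  · refine (min_le_right _ _).trans ((min_le_right _ _).trans ?_)
    have h1 := T.norm_cpressure_le q (x + t₀ * I)
    have h2 := (T.pressure_strictAnti q).antitone h'
    have h3 := norm_sub_norm_le 1 (T.cpressure q (x + t₀ * I))
    simp at h1 h3
    linarith

/-- A vertical shift by `n` multiplies the `i`-th term by `r_i^{in}`. -/
theorem norm_cpressure_add_sub_le {x t ε : ℝ} {n : ℕ}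
    (hn : ∀ i, ‖(T.ratio i : ℂ) ^ ((n : ℂ) * I) - 1‖ ≤ ε) :
    ‖T.cpressure q (x + (t + n : ℝ) * I) - T.cpressure q (x + t * I)‖ ≤ ε * T.pressure q x := by
  rw [cpressure, cpressure, ← Finset.sum_sub_distrib, pressure, Finset.mul_sum]
  refine (norm_sum_le _ _).trans (Finset.sum_le_sum fun i _ => ?_)
  have hr : (T.ratio i : ℂ) ≠ 0 := ofReal_ne_zero.2 (T.ratio_pos i).ne'
  have : ((T.prob i ^ q : ℝ) : ℂ) * (T.ratio i : ℂ) ^ (x + (t + n : ℝ) * I : ℂ) -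
      ((T.prob i ^ q : ℝ) : ℂ) * (T.ratio i : ℂ) ^ (x + t * I : ℂ) =
      ((T.ratio i : ℂ) ^ ((n : ℂ) * I) - 1) *
        (((T.prob i ^ q : ℝ) : ℂ) * (T.ratio i : ℂ) ^ (x + t * I : ℂ)) := by
    rw [show (x + (t + n : ℝ) * I : ℂ) = n * I + (x + t * I) by push_cast; ring,
      cpow_add _ _ hr]
    ring
  rw [this, norm_mul, T.norm_cpressure_term]
  simp only [add_re, ofReal_re, mul_re, I_re, mul_zero, ofReal_im, I_im, mul_one, sub_self,
    add_zero]
  exact mul_le_mul_of_nonneg_right (hn i) (T.pressure_term_pos q i x).le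

theorem exists_isGrowthSequence : ∃ t : ℕ → ℝ, StrictMono t ∧ T.IsGrowthSequence q t := by
  obtain ⟨t₀, ht₀, hne⟩ := T.exists_pos_forall_cpressure_ne_one q
  obtain ⟨δ, hδ, hlow⟩ := T.exists_pos_le_norm_one_sub_cpressure q hne
  obtain ⟨x₀, hx₀⟩ := T.exists_two_le_norm_cpressure q
  have hP := T.pressure_pos q x₀
  -- The pressure is decreasing, so for `x ≥ x₀` this `ε` keeps the perturbation below `δ / 2`. For
  -- `x ≤ x₀` the modulus is at least `2` at any height.
  set ε := δ / (2 * T.pressure q x₀) with hε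
  have hε0 : 0 < ε := by positivity
  have hfreq : ∃ᶠ n : ℕ in atTop, ∀ i, ‖(T.ratio i : ℂ) ^ ((n : ℂ) * I) - 1‖ ≤ ε :=
    frequently_atTop.2 fun M => T.exists_nat_norm_cpow_sub_one_le hε0 M
  obtain ⟨φ, hφ, hφε⟩ := extraction_of_frequently_atTop hfreq
  set t : ℕ → ℝ := fun n => t₀ + φ n with ht
  have hright : ∀ (n : ℕ) (x : ℝ), x₀ ≤ x → δ / 2 ≤ ‖1 - T.cpressure q (x + t n * I)‖ := by
    intro n x hx
    have h1 := T.norm_cpressure_add_sub_le q (x := x) (t := t₀) (hφε n)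
    have h2 := hlow x
    have h3 : ε * T.pressure q x ≤ δ / 2 := by
      calc ε * T.pressure q x ≤ ε * T.pressure q x₀ :=
            mul_le_mul_of_nonneg_left ((T.pressure_strictAnti q).antitone hx) hε0.le
        _ = δ / 2 := by rw [hε]; field_simp
    have h4 := norm_sub_norm_le (1 - T.cpressure q (x + t₀ * I))
      (T.cpressure q (x + (t₀ + φ n : ℝ) * I) - T.cpressure q (x + t₀ * I))
    rw [sub_sub_sub_cancel_right] at h4
    linarith
  have hreg : ∀ (n : ℕ) (x : ℝ), T.cpressure q (x + t n * I) ≠ 1 := by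
    intro n x
    rcases le_total x x₀ with h | h
    · exact T.cpressure_ne_one_of_two_le q (hx₀ _ (by simpa using h))
    · intro h1
      have := hright n x h
      rw [h1, sub_self, norm_zero] at this
      linarith
  have hbd : ∀ (n : ℕ) (x : ℝ),
      ‖T.zeta q (x + t n * I)‖ ≤ max 2 (T.pressure q x₀ / (δ / 2)) := by
    intro n x
    rcases le_total x x₀ with h | h
    · exact (T.norm_zeta_le_two q (hx₀ _ (by simpa using h))).trans (le_max_left _ _)
    · refine le_trans ?_ (le_max_right _ _)
      rw [zeta, norm_div]
      refine div_le_div₀ hP.le ?_ (by positivity) (hright n x h)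
      refine (T.norm_cpressure_le q _).trans ?_
      simpa using (T.pressure_strictAnti q).antitone h
  -- The lower half-lines follow from the upper ones by conjugation symmetry.
  have hconj : ∀ (n : ℕ) (x : ℝ), (x - t n * I : ℂ) = (starRingEnd ℂ) (x + t n * I) := by
    intro n x
    simp [sub_eq_add_neg]
  have hmono : StrictMono t := fun a b hab => by
    simpa [ht] using hφ hab
  refine ⟨t, hmono, hmono.monotone, fun n => by positivity, ?_, fun n x => ⟨hreg n x, ?_⟩,
    fun c => ⟨_, fun x _ n => ⟨hbd n x, ?_⟩⟩⟩
  · exact tendsto_atTop_add_const_left _ _ (tendsto_natCast_atTop_atTop.comp hφ.tendsto_atTop)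
  · rw [hconj, cpressure_conj]
    intro h
    apply hreg n x
    simpa using congrArg (starRingEnd ℂ) h
  · rw [hconj, zeta_conj, RCLike.norm_conj]
    exact hbd n x

end SelfSimilarSystem

end

/-! ### Mellin inversion for the truncated power sum. -/

noncomputable section

open MeasureTheory

section Perron

variable {ι : Type*} [Fintype ι] (b e : ι → ℝ)

/-- The rational function `∑ₗ bₗ / (s - eₗ)`. -/
def simplePoleSum (s : ℂ) : ℂ := ∑ l, (b l : ℂ) / (s - e l)

/-- The function `∑ₗ bₗ x^{-eₗ}` on `(0, 1]`, continued by its value at `1`. -/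
def truncatedPowerSum (x : ℝ) : ℂ := ∑ l, (b l : ℂ) * ((min x 1 : ℝ) : ℂ) ^ (-(e l : ℂ))

variable {b e}

/-- The value at `1` is `∑ l, b l`. Continuity at `1` is built into `min x 1`; consistency is what
makes the continuation zero. -/
theorem truncatedPowerSum_of_one_le (hb : ∑ l, b l = 0) {x : ℝ} (hx : 1 ≤ x) :
    truncatedPowerSum b e x = 0 := by
  simp only [truncatedPowerSum, min_eq_right hx, ofReal_one, one_cpow, mul_one, ← ofReal_sum, hb,
    ofReal_zero]

theorem continuousAt_truncatedPowerSum {x : ℝ} (hx : 0 < x) :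
    ContinuousAt (truncatedPowerSum b e) x := by
  refine tendsto_finsetSum _ fun l _ => Tendsto.const_mul _ ?_
  refine Tendsto.comp (g := fun z : ℂ => z ^ (-(e l : ℂ)))
    (y := 𝓝 (((min x 1 : ℝ) : ℂ))) ?_ ?_
  · exact ContinuousAt.cpow continuousAt_id continuousAt_const
      (ofReal_mem_slitPlane.2 (lt_min hx one_pos))
  · exact Continuous.tendsto (f := fun x : ℝ => ((min x 1 : ℝ) : ℂ)) (by fun_prop) x

theorem hasMellin_finset_sum {κ : Type*} (S : Finset κ) (f : κ → ℝ → ℂ) (m : κ → ℂ) {s : ℂ}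
    (h : ∀ i ∈ S, HasMellin (f i) s (m i)) :
    HasMellin (fun t => ∑ i ∈ S, f i t) s (∑ i ∈ S, m i) := by
  classical
  induction S using Finset.induction_on with
  | empty =>
    simp only [Finset.sum_empty]
    refine ⟨?_, ?_⟩
    · simp [MellinConvergent]
    · simp [mellin]
  | insert i S hi ih =>
    have h1 := h i (Finset.mem_insert_self _ _)
    have h2 := ih fun j hj => h j (Finset.mem_insert_of_mem hj)
    simp only [Finset.sum_insert hi]
    rw [← h1.2, ← h2.2]
    exact hasMellin_add h1.1 h2.1

/-- Each term reduces to `∫₀¹ x^{s - 1 - e l} dx = 1 / (s - e l)`. -/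
theorem hasMellin_truncatedPowerSum (hb : ∑ l, b l = 0) {s : ℂ} (hs : ∀ l, e l < s.re) :
    HasMellin (truncatedPowerSum b e) s (simplePoleSum b e s) := by
  have key : HasMellin (fun t : ℝ => ∑ l, (b l : ℂ) *
      Set.indicator (Set.Ioc 0 1) (fun t : ℝ => (t : ℂ) ^ (-(e l : ℂ))) t) s
      (simplePoleSum b e s) := by
    refine hasMellin_finset_sum _ _ _ fun l _ => ?_
    have h1 := hasMellin_cpow_Ioc (-(e l : ℂ)) (s := s) (by simpa using hs l)
    have h2 := hasMellin_const_smul h1.1 (b l : ℂ)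
    rw [h1.2] at h2
    simpa [div_eq_mul_inv, sub_eq_add_neg] using h2
  have heq : ∀ t ∈ Set.Ioi (0 : ℝ), truncatedPowerSum b e t = ∑ l, (b l : ℂ) *
      Set.indicator (Set.Ioc 0 1) (fun t : ℝ => (t : ℂ) ^ (-(e l : ℂ))) t := by
    intro t ht
    rcases le_or_gt t 1 with h | h
    · refine Finset.sum_congr rfl fun l _ => ?_
      rw [Set.indicator_of_mem (show t ∈ Set.Ioc (0 : ℝ) 1 from ⟨ht, h⟩), min_eq_left h]
    · rw [truncatedPowerSum_of_one_le hb h.le]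
      refine (Finset.sum_eq_zero fun l _ => ?_).symm
      rw [Set.indicator_of_notMem fun h' => absurd h'.2 (not_le.2 h), mul_zero]
  refine ⟨?_, ?_⟩
  · refine key.1.congr_fun (fun t ht => ?_) measurableSet_Ioi
    simp only [heq t ht]
  · rw [← key.2, mellin, mellin]
    exact setIntegral_congr_fun measurableSet_Ioi fun t ht => by simp only [heq t ht]

theorem sqrt_one_add_sq_le_norm {u : ℝ} (hu : 1 ≤ u) (y : ℝ) :
    √(1 + y ^ 2) ≤ ‖(u + y * I : ℂ)‖ := by
  rw [norm_add_mul_I]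
  exact Real.sqrt_le_sqrt (by nlinarith)

/-- Since `∑ l, b l = 0`, the term `b l / (1 + iy)`, with its pole at `c - 1`, may be subtracted
from each summand. The differences have two linear factors in the denominator, hence quadratic
decay. -/
theorem norm_simplePoleSum_le (hb : ∑ l, b l = 0) {c : ℝ} (hc : ∀ l, e l + 1 ≤ c) (y : ℝ) :
    ‖simplePoleSum b e (c + y * I)‖ ≤ (∑ l, |b l * (e l - (c - 1))|) * (1 + y ^ 2)⁻¹ := by
  have hpos : 0 < √(1 + y ^ 2) := Real.sqrt_pos.2 (by positivity)
  have h0 := sqrt_one_add_sq_le_norm le_rfl y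
  have h0' : (1 + y * I : ℂ) ≠ 0 := norm_pos_iff.1 (hpos.trans_le (by simpa using h0))
  have hl := fun l => sqrt_one_add_sq_le_norm (u := c - e l) (by linarith [hc l]) y
  have hl' : ∀ l, (c - e l + y * I : ℂ) ≠ 0 := fun l =>
    norm_pos_iff.1 (hpos.trans_le (by simpa using hl l))
  have hsum : simplePoleSum b e (c + y * I) =
      ∑ l, ((b l * (e l - (c - 1)) : ℝ) : ℂ) / ((c - e l + y * I) * (1 + y * I)) := by
    have hz : ∑ l, (b l : ℂ) / (1 + y * I) = 0 := by
      rw [← Finset.sum_div, ← ofReal_sum, hb]; simp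
    rw [simplePoleSum, ← sub_zero (∑ l, _), ← hz, ← Finset.sum_sub_distrib]
    refine Finset.sum_congr rfl fun l _ => ?_
    rw [show (c + y * I - e l : ℂ) = c - e l + y * I by ring]
    have := hl' l
    push_cast
    field_simp
    ring
  rw [hsum, Finset.sum_mul]
  refine (norm_sum_le _ _).trans (Finset.sum_le_sum fun l _ => ?_)
  rw [norm_div, norm_mul, norm_real, Real.norm_eq_abs, div_eq_mul_inv]
  refine mul_le_mul_of_nonneg_left (inv_anti₀ (by positivity) ?_) (abs_nonneg _)
  calc 1 + y ^ 2 = √(1 + y ^ 2) * √(1 + y ^ 2) := (Real.mul_self_sqrt (by positivity)).symm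
    _ ≤ _ := mul_le_mul (by simpa using hl l) (by simpa using h0) hpos.le (norm_nonneg _)

theorem continuous_vertical_simplePoleSum {c : ℝ} (hc : ∀ l, e l < c) :
    Continuous fun y : ℝ => simplePoleSum b e (c + y * I) := by
  refine continuous_finsetSum _ fun l _ => Continuous.div continuous_const (by fun_prop) ?_
  intro y h
  have := congrArg re h
  simp at this
  linarith [hc l]

theorem integrable_vertical_simplePoleSum (hb : ∑ l, b l = 0) {c : ℝ}
    (hc : ∀ l, e l + 1 ≤ c) : Integrable fun y : ℝ => simplePoleSum b e (c + y * I) :=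
  (integrable_inv_one_add_sq.const_mul (∑ l, |b l * (e l - (c - 1))|)).mono'
    (continuous_vertical_simplePoleSum fun l => by linarith [hc l]).aestronglyMeasurable
    (Eventually.of_forall fun y => norm_simplePoleSum_le hb hc y)

theorem integral_cpow_mul_simplePoleSum (hb : ∑ l, b l = 0) {c x : ℝ}
    (hc : ∀ l, e l + 1 ≤ c) (hx : 0 < x) :
    ∫ y : ℝ, (x : ℂ) ^ (-(c + y * I : ℂ)) * simplePoleSum b e (c + y * I) =
      2 * Real.pi * truncatedPowerSum b e x := by
  have hlt : ∀ l, e l < c := fun l => by linarith [hc l]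
  have hm : ∀ y : ℝ, mellin (truncatedPowerSum b e) (c + y * I) =
      simplePoleSum b e (c + y * I) := fun y =>
    (hasMellin_truncatedPowerSum hb (by simpa using hlt)).2
  have h := mellinInv_mellin_eq c (truncatedPowerSum b e) hx
    (hasMellin_truncatedPowerSum hb (by simpa using hlt)).1
    (by
      simp only [VerticalIntegrable, hm]
      exact integrable_vertical_simplePoleSum hb hc)
    (continuousAt_truncatedPowerSum hx)
  simp only [mellinInv, hm, smul_eq_mul, real_smul] at h
  have hπ : (2 * Real.pi : ℂ) * ((1 / (2 * Real.pi) : ℝ) : ℂ) = 1 := by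
    have : (Real.pi : ℂ) ≠ 0 := ofReal_ne_zero.2 Real.pi_ne_zero
    push_cast
    field_simp
  rw [← h, ← mul_assoc, hπ, one_mul]

end Perron

/-! ### Integrating the zeta series term by term. -/

namespace SelfSimilarSystem

variable {d N : ℕ} (T : SelfSimilarSystem d N) (q : ℝ)

theorem wordRatio_pos (w : List (Fin N)) : 0 < T.wordRatio w := by
  refine List.prod_pos fun x hx => ?_
  obtain ⟨i, _, rfl⟩ := List.mem_map.1 hx
  exact T.ratio_pos i

theorem wordProb_pos (w : List (Fin N)) : 0 < T.wordProb w := by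
  refine List.prod_pos fun x hx => ?_
  obtain ⟨i, _, rfl⟩ := List.mem_map.1 hx
  exact T.prob_pos i

theorem continuous_vertical_zeta {c : ℝ} (hc : T.beta q < c) :
    Continuous fun y : ℝ => T.zeta q (c + y * I) := by
  have h := (T.differentiable_cpressure q).continuous.comp
    (show Continuous fun y : ℝ => (c + y * I : ℂ) by fun_prop)
  refine h.div (continuous_const.sub h) fun y => sub_ne_zero.2 ?_
  exact (T.cpressure_ne_one_of_beta_lt q (by simpa using hc)).symm

theorem norm_zeta_le_of_beta_lt {s : ℂ} (hs : T.beta q < s.re) :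
    ‖T.zeta q s‖ ≤ T.pressure q s.re / (1 - T.pressure q s.re) := by
  have h1 := (T.norm_cpressure_lt_one hs).1
  have h2 := T.norm_cpressure_le q s
  have h3 := norm_sub_norm_le 1 (T.cpressure q s)
  rw [norm_one] at h3
  rw [zeta, norm_div]
  exact div_le_div₀ (T.pressure_pos q _).le h2 (by linarith) (by linarith)

variable {ι : Type*} [Fintype ι] {b e : ι → ℝ}

theorem norm_ofReal_cpow_neg_vertical {r : ℝ} (hr : 0 < r) (c y : ℝ) :
    ‖(r : ℂ) ^ (-(c + y * I : ℂ))‖ = r ^ (-c) := by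
  rw [norm_cpow_eq_rpow_re_of_pos hr]; simp

theorem continuous_ofReal_cpow_neg_vertical {r : ℝ} (hr : 0 < r) (c : ℝ) :
    Continuous fun y : ℝ => (r : ℂ) ^ (-(c + y * I : ℂ)) :=
  Continuous.const_cpow (by fun_prop) (Or.inl (ofReal_ne_zero.2 hr.ne'))

theorem integrable_vertical_simplePoleSum_mul_zeta (hb : ∑ l, b l = 0) {c r : ℝ}
    (hc : ∀ l, e l + 1 ≤ c) (hβ : T.beta q < c) (hr : 0 < r) :
    Integrable fun y : ℝ => simplePoleSum b e (c + y * I) * T.zeta q (c + y * I) *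
      (r : ℂ) ^ (-(c + y * I : ℂ)) := by
  refine Integrable.mul_bdd (c := r ^ (-c))
    (Integrable.mul_bdd (c := T.pressure q c / (1 - T.pressure q c))
      (integrable_vertical_simplePoleSum hb hc)
      (T.continuous_vertical_zeta q hβ).aestronglyMeasurable (Eventually.of_forall fun y => ?_))
    (continuous_ofReal_cpow_neg_vertical hr c).aestronglyMeasurable
    (Eventually.of_forall fun y => (norm_ofReal_cpow_neg_vertical hr c y).le)
  simpa using T.norm_zeta_le_of_beta_lt q (s := c + y * I) (by simpa using hβ)

/-- Sum and integral may be interchanged: the integral of the norm of the term of `w` is a constant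
times `p_w^q r_w^c`, which is summable because `c > β(q)`. -/
theorem hasSum_integral_vertical (hb : ∑ l, b l = 0) {c r : ℝ}
    (hc : ∀ l, e l + 1 ≤ c) (hβ : T.beta q < c) (hr : 0 < r) :
    HasSum (fun w : {w : List (Fin N) // w ≠ []} => 2 * Real.pi *
        (((T.wordProb w ^ q : ℝ) : ℂ) * truncatedPowerSum b e (r / T.wordRatio w)))
      (∫ y : ℝ, simplePoleSum b e (c + y * I) * T.zeta q (c + y * I) *
        (r : ℂ) ^ (-(c + y * I : ℂ))) := by
  have hpos : ∀ w, 0 < r / T.wordRatio w := fun w => div_pos hr (T.wordRatio_pos w)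
  set F : {w : List (Fin N) // w ≠ []} → ℝ → ℂ := fun w y => ((T.wordProb w ^ q : ℝ) : ℂ) *
    (((r / T.wordRatio w : ℝ) : ℂ) ^ (-(c + y * I : ℂ)) * simplePoleSum b e (c + y * I)) with hF
  have hint : ∀ w, Integrable (F w) := fun w =>
    ((integrable_vertical_simplePoleSum hb hc).bdd_mul (c := (r / T.wordRatio w) ^ (-c))
      (continuous_ofReal_cpow_neg_vertical (hpos w) c).aestronglyMeasurable
      (Eventually.of_forall fun y =>
        (norm_ofReal_cpow_neg_vertical (hpos w) c y).le)).const_mul _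
  have hnorm : ∀ w : {w : List (Fin N) // w ≠ []}, ∫ y, ‖F w y‖ =
      ‖((T.wordProb w ^ q : ℝ) : ℂ) * (T.wordRatio w : ℂ) ^ (c : ℂ)‖ *
        (r ^ (-c) * ∫ y : ℝ, ‖simplePoleSum b e (c + y * I)‖) := by
    intro w
    rw [← integral_const_mul, ← integral_const_mul]
    congr 1
    ext y
    rw [hF]
    simp only [norm_mul]
    rw [norm_ofReal_cpow_neg_vertical (hpos w), Real.div_rpow hr.le (T.wordRatio_pos w).le,
      norm_cpow_eq_rpow_re_of_pos (T.wordRatio_pos w), ofReal_re,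
      Real.rpow_neg (T.wordRatio_pos w).le c, div_inv_eq_mul]
    ring
  have hsum : Summable fun w => ∫ y, ‖F w y‖ := by
    simp only [hnorm]
    exact (T.hasSum_zeta (s := (c : ℂ)) (by simpa using hβ)).summable.norm.mul_right _
  have h := hasSum_integral_of_summable_integral_norm hint hsum
  have hl : ∀ w : {w : List (Fin N) // w ≠ []}, 2 * Real.pi * (((T.wordProb w ^ q : ℝ) : ℂ) *
      truncatedPowerSum b e (r / T.wordRatio w)) = ∫ y, F w y := fun w => by
    rw [hF, integral_const_mul, integral_cpow_mul_simplePoleSum hb hc (hpos w)]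
    ring
  have hsums : ∀ y : ℝ, simplePoleSum b e (c + y * I) * T.zeta q (c + y * I) *
      (r : ℂ) ^ (-(c + y * I : ℂ)) = ∑' w, F w y := fun y => by
    have hz := (T.hasSum_zeta (s := c + y * I) (q := q) (by simpa using hβ)).mul_left
      ((r : ℂ) ^ (-(c + y * I : ℂ)) * simplePoleSum b e (c + y * I))
    have heq : ∀ w, F w y = (r : ℂ) ^ (-(c + y * I : ℂ)) * simplePoleSum b e (c + y * I) *
        (((T.wordProb w ^ q : ℝ) : ℂ) * (T.wordRatio w : ℂ) ^ (c + y * I : ℂ)) := by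
      intro w
      rw [hF]
      simp only
      rw [div_eq_mul_inv, ofReal_mul, mul_cpow_ofReal_nonneg hr.le
        (inv_nonneg.2 (T.wordRatio_pos w).le), ofReal_inv, inv_cpow _ _ (by
          simp [arg_ofReal_of_nonneg (T.wordRatio_pos w).le, Real.pi_ne_zero.symm]), cpow_neg
        (T.wordRatio w : ℂ), inv_inv]
      ring
    simp only [heq]
    rw [hz.tsum_eq]
    ring
  simp only [hl, hsums]
  exact h

end SelfSimilarSystem

end

/-! ### Word combinatorics and the volume as a vertical integral. -/

noncomputable section

namespace SelfSimilarSystem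

variable {d N : ℕ} (T : SelfSimilarSystem d N) (q : ℝ)

/-- The weight `p_𝐢^q r_𝐢^t` of a word. -/
def wordWeight (t : ℝ) (w : List (Fin N)) : ℝ := T.wordProb w ^ q * T.wordRatio w ^ t

theorem wordRatio_append_singleton (w : List (Fin N)) (i : Fin N) :
    T.wordRatio (w ++ [i]) = T.wordRatio w * T.ratio i := by
  simp [wordRatio]

theorem wordProb_append_singleton (w : List (Fin N)) (i : Fin N) :
    T.wordProb (w ++ [i]) = T.wordProb w * T.prob i := by
  simp [wordProb]

theorem wordWeight_append_singleton (t : ℝ) (w : List (Fin N)) (i : Fin N) :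
    T.wordWeight q t (w ++ [i]) = T.wordWeight q t w * (T.prob i ^ q * T.ratio i ^ t) := by
  rw [wordWeight, wordWeight, wordRatio_append_singleton, wordProb_append_singleton,
    Real.mul_rpow (T.wordProb_pos w).le (T.prob_pos i).le,
    Real.mul_rpow (T.wordRatio_pos w).le (T.ratio_pos i).le]
  ring

theorem wordRatio_lt_dropLast {w : List (Fin N)} (hw : w ≠ []) :
    T.wordRatio w < T.wordRatio w.dropLast := by
  conv_lhs => rw [← List.dropLast_append_getLast hw, wordRatio_append_singleton]
  exact mul_lt_of_lt_one_right (T.wordRatio_pos _) (T.ratio_lt_one _)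

/-- A non-empty word is `u ++ [i]` for unique `u` and `i`, and the weight is multiplicative, so the
sum over `i` factors out as the pressure. -/
theorem finsum_wordWeight_dropLast (t : ℝ) (p : ℝ → Prop)
    (hp : {u : List (Fin N) | p (T.wordRatio u)}.Finite) :
    ∑ᶠ w ∈ {w : List (Fin N) | w ≠ [] ∧ p (T.wordRatio w.dropLast)}, T.wordWeight q t w =
      T.pressure q t * ∑ᶠ u ∈ {u : List (Fin N) | p (T.wordRatio u)}, T.wordWeight q t u := by
  set S := hp.toFinset with hS
  have hmem : ∀ u, u ∈ S ↔ p (T.wordRatio u) := fun u => by simp [hS]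
  have hbij : Set.BijOn (fun x : List (Fin N) × Fin N => x.1 ++ [x.2])
      (↑(S ×ˢ (Finset.univ : Finset (Fin N))))
      {w : List (Fin N) | w ≠ [] ∧ p (T.wordRatio w.dropLast)} := by
    refine ⟨?_, ?_, ?_⟩
    · rintro ⟨u, i⟩ hu
      have : u ∈ S := by simpa using hu
      simpa using (hmem u).1 this
    · rintro ⟨u, i⟩ _ ⟨v, j⟩ _ h
      have h' := List.append_inj' h rfl
      simpa using h'
    · rintro w ⟨hw, hpw⟩
      refine ⟨(w.dropLast, w.getLast hw), ?_, List.dropLast_append_getLast hw⟩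
      simpa using (hmem _).2 hpw
  rw [← finsum_mem_eq_of_bijOn _ hbij fun x _ => T.wordWeight_append_singleton q t x.1 x.2 |>.symm,
    finsum_mem_coe_finset, Finset.sum_product, finsum_mem_eq_finite_toFinset_sum _ hp, pressure,
    Finset.mul_sum]
  refine Finset.sum_congr rfl fun u _ => ?_
  rw [Finset.sum_mul]
  exact Finset.sum_congr rfl fun i _ => mul_comm _ _

theorem finite_setOf_lt_wordRatio {r : ℝ} (hr : 0 < r) :
    {w : List (Fin N) | w ≠ [] ∧ r < T.wordRatio w}.Finite :=
  (T.finite_words hr).subset fun _ hw => ⟨hw.1, (hw.2.trans (T.wordRatio_lt_dropLast hw.1)).le⟩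

theorem finite_setOf_eq_wordRatio {r : ℝ} (hr : 0 < r) (hr1 : r < 1) :
    {w : List (Fin N) | r = T.wordRatio w}.Finite := by
  refine (T.finite_words hr).subset fun w hw => ?_
  have hw0 : w ≠ [] := by
    rintro rfl
    exact hr1.ne (by simpa [wordRatio] using hw)
  exact ⟨hw0, (Eq.trans_lt hw (T.wordRatio_lt_dropLast hw0)).le⟩

theorem setOf_lt_wordRatio_eq_insert {r : ℝ} (hr1 : r < 1) :
    {w : List (Fin N) | r < T.wordRatio w} =
      insert [] {w : List (Fin N) | w ≠ [] ∧ r < T.wordRatio w} := by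
  ext w
  by_cases hw : w = []
  · simp [hw, wordRatio, hr1]
  · simp [hw]

/-- The weighted count of words in terms of sums over the words of ratio larger than `r` and of
ratio equal to `r`. -/
theorem symCount_eq {r : ℝ} (hr : 0 < r) (hr1 : r < 1) (l : ℕ) :
    T.symCount q l r = (T.sigma q l - 1) *
        ∑ᶠ w ∈ {w : List (Fin N) | w ≠ [] ∧ r < T.wordRatio w}, T.wordWeight q (l - d * q) w +
      T.sigma q l + (T.sigma q l - 1) / 2 *
        ∑ᶠ w ∈ {w : List (Fin N) | r = T.wordRatio w}, T.wordWeight q (l - d * q) w := by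
  set a := T.wordWeight q (l - d * q) with ha
  have hU := T.finite_setOf_lt_wordRatio hr
  have hE := T.finite_setOf_eq_wordRatio hr hr1
  have hU' : {w : List (Fin N) | r < T.wordRatio w}.Finite := by
    rw [T.setOf_lt_wordRatio_eq_insert hr1]; exact hU.insert _
  have hS1 : {w : List (Fin N) | w ≠ [] ∧ T.wordRatio w < r ∧ r < T.wordRatio w.dropLast}.Finite :=
    (T.finite_words hr).subset fun w hw => ⟨hw.1, hw.2.2.le⟩
  have e1 := T.finsum_wordWeight_dropLast q (l - d * q) (fun x => r < x) hU'
  have e2 := T.finsum_wordWeight_dropLast q (l - d * q) (fun x => r = x) hE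
  -- The words with parent above `r` are split by comparing their own ratio with `r`. As `r < 1`, no
  -- word of ratio `r` is empty.
  have e3 : {w : List (Fin N) | w ≠ [] ∧ r < T.wordRatio w.dropLast} =
      {w : List (Fin N) | w ≠ [] ∧ T.wordRatio w < r ∧ r < T.wordRatio w.dropLast} ∪
        ({w : List (Fin N) | w ≠ [] ∧ r < T.wordRatio w} ∪
          {w : List (Fin N) | r = T.wordRatio w}) := by
    ext w
    simp only [Set.mem_ofPred_eq, Set.mem_union]
    constructor
    · rintro ⟨h1, h2⟩
      rcases lt_trichotomy (T.wordRatio w) r with h | h | h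
      · exact Or.inl ⟨h1, h, h2⟩
      · exact Or.inr (Or.inr h.symm)
      · exact Or.inr (Or.inl ⟨h1, h⟩)
    · rintro (h | h | h)
      · exact ⟨h.1, h.2.2⟩
      · exact ⟨h.1, h.2.trans (T.wordRatio_lt_dropLast h.1)⟩
      · have hw0 : w ≠ [] := by
          rintro rfl
          exact hr1.ne (by simpa [wordRatio] using h)
        exact ⟨hw0, h.trans_lt (T.wordRatio_lt_dropLast hw0)⟩
  rw [e3, finsum_mem_union (Set.disjoint_left.2 ?_) hS1 (hU.union hE),
    finsum_mem_union (Set.disjoint_left.2 ?_) hU hE, T.setOf_lt_wordRatio_eq_insert hr1,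
    finsum_mem_insert _ (by simp) hU] at e1
  · have hnil : T.wordWeight q (l - d * q) [] = 1 := by simp [wordWeight, wordRatio, wordProb]
    have hσ : T.pressure q (l - d * q) = T.sigma q l := rfl
    have hσ0 : T.sigma q l ≠ 0 := (T.pressure_pos q _).ne'
    rw [hnil, hσ, ← ha] at e1
    rw [hσ, ← ha] at e2
    have hC : T.symCount q l r =
        (∑ᶠ w ∈ {w : List (Fin N) | w ≠ [] ∧ T.wordRatio w < r ∧ r < T.wordRatio w.dropLast}, a w) +
          (1 + 1 / T.sigma q l) / 2 *
            ∑ᶠ w ∈ {w : List (Fin N) | w ≠ [] ∧ r = T.wordRatio w.dropLast}, a w := rfl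
    -- The empty word supplies the lone `σ`. Words of ratio `r` enter with `-1` from `e1` and `(σ +
    -- 1) / 2` from `e2`, in total `(σ - 1) / 2`.
    rw [hC, e2, eq_sub_of_add_eq e1]
    field_simp
    ring
  · rintro w hw hw'
    exact hw.2.ne hw'
  · rintro w ⟨_, hw, _⟩ (hw' | hw')
    · exact hw.not_gt hw'.2
    · exact hw.ne' hw'

/-- The consistent coefficients `κ_l (σ_{q,l} - 1)`. -/
def residueCoeff (κ : Fin (d + 1) → ℝ) (l : Fin (d + 1)) : ℝ := κ l * (T.sigma q l - 1)

variable {q} in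
theorem sum_residueCoeff {κ : Fin (d + 1) → ℝ} (hκ : T.IsConsistent q κ) :
    ∑ l, T.residueCoeff q κ l = 0 := hκ

variable (d) in
/-- The exponents `l - dq`. -/
def poleExponent (l : Fin (d + 1)) : ℝ := (l : ℕ) - d * q

/-- A word of ratio exactly `r` contributes `p_w^q` after multiplication by `r^{-e_l}`,
independently of `l`. Its total coefficient is half of `∑ κ_l (σ_{q,l} - 1) = 0`. -/
theorem symVolume_eq (κ : Fin (d + 1) → ℝ) (hκ : T.IsConsistent q κ) {r : ℝ} (hr : 0 < r)
    (hr1 : r < 1) :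
    T.symVolume q κ r =
      ∑ᶠ w ∈ {w : List (Fin N) | w ≠ [] ∧ r < T.wordRatio w}, T.wordProb w ^ q *
        (∑ l, T.residueCoeff q κ l * (r / T.wordRatio w) ^ (-poleExponent d q l)) +
      ∑ l : Fin (d + 1), κ l * T.sigma q l * r ^ (-poleExponent d q l) := by
  have hU := T.finite_setOf_lt_wordRatio hr
  have hE := T.finite_setOf_eq_wordRatio hr hr1
  have hpow : ∀ l : Fin (d + 1), 1 / r ^ d * r ^ (((d : ℝ) - (l : ℕ)) + d * q) =
      r ^ (-poleExponent d q l) := fun l => by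
    rw [one_div, ← Real.rpow_natCast, ← Real.rpow_neg hr.le, ← Real.rpow_add hr, poleExponent]
    congr 1; ring
  have hV : T.symVolume q κ r = ∑ l : Fin (d + 1),
      κ l * T.symCount q l r * r ^ (-poleExponent d q l) := by
    rw [symVolume, Finset.mul_sum]
    exact Finset.sum_congr rfl fun l _ => by rw [← hpow l]; ring
  have hEsum : ∀ l : Fin (d + 1),
      (∑ᶠ w ∈ {w : List (Fin N) | r = T.wordRatio w}, T.wordWeight q (poleExponent d q l) w) *
        r ^ (-poleExponent d q l) =
      ∑ᶠ w ∈ {w : List (Fin N) | r = T.wordRatio w}, T.wordProb w ^ q := fun l => by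
    rw [finsum_mem_eq_finite_toFinset_sum _ hE, finsum_mem_eq_finite_toFinset_sum _ hE,
      Finset.sum_mul]
    refine Finset.sum_congr rfl fun w hw => ?_
    have : r = T.wordRatio w := by simpa using hw
    rw [wordWeight, ← this, mul_assoc, ← Real.rpow_add hr, add_neg_cancel, Real.rpow_zero, mul_one]
  have hUsum : ∀ l : Fin (d + 1),
      (∑ᶠ w ∈ {w : List (Fin N) | w ≠ [] ∧ r < T.wordRatio w},
        T.wordWeight q (poleExponent d q l) w) * r ^ (-poleExponent d q l) =
      ∑ w ∈ hU.toFinset, T.wordProb w ^ q * (r / T.wordRatio w) ^ (-poleExponent d q l) :=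
    fun l => by
    rw [finsum_mem_eq_finite_toFinset_sum _ hU, Finset.sum_mul]
    refine Finset.sum_congr rfl fun w hw => ?_
    rw [wordWeight, Real.div_rpow hr.le (T.wordRatio_pos w).le,
      Real.rpow_neg (T.wordRatio_pos w).le, div_inv_eq_mul]
    ring
  have hterm : ∀ l : Fin (d + 1), κ l * T.symCount q l r * r ^ (-poleExponent d q l) =
      (∑ w ∈ hU.toFinset, T.wordProb w ^ q *
        (T.residueCoeff q κ l * (r / T.wordRatio w) ^ (-poleExponent d q l))) +
      κ l * T.sigma q l * r ^ (-poleExponent d q l) + κ l * (T.sigma q l - 1) *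
        ((∑ᶠ w ∈ {w : List (Fin N) | r = T.wordRatio w}, T.wordProb w ^ q) / 2) := fun l => by
    rw [← hEsum l, T.symCount_eq q hr hr1]
    have h1 := hUsum l
    have h2 : (∑ w ∈ hU.toFinset, T.wordProb w ^ q *
        (T.residueCoeff q κ l * (r / T.wordRatio w) ^ (-poleExponent d q l))) =
        T.residueCoeff q κ l * ∑ w ∈ hU.toFinset,
          T.wordProb w ^ q * (r / T.wordRatio w) ^ (-poleExponent d q l) := by
      rw [Finset.mul_sum]
      exact Finset.sum_congr rfl fun w _ => by ring
    rw [h2, ← h1, residueCoeff]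
    simp only [poleExponent]
    ring
  rw [hV, Finset.sum_congr rfl fun l _ => hterm l, Finset.sum_add_distrib, Finset.sum_add_distrib,
    ← Finset.sum_mul]
  have hκ' : ∑ l : Fin (d + 1), κ l * (T.sigma q l - 1) = 0 := hκ
  rw [hκ', zero_mul, add_zero, Finset.sum_comm, finsum_mem_eq_finite_toFinset_sum _ hU]
  simp only [Finset.mul_sum]

/-- The truncated power sum vanishes for words of ratio at most `r`, so the series over all words
collapses to the finite sum in `symVolume_eq`. -/
theorem integral_vertical_eq (κ : Fin (d + 1) → ℝ) (hκ : T.IsConsistent q κ) {c r : ℝ}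
    (hc : ∀ l, poleExponent d q l + 1 ≤ c) (hβ : T.beta q < c) (hr : 0 < r) (hr1 : r < 1) :
    ∫ y : ℝ, simplePoleSum (T.residueCoeff q κ) (poleExponent d q) (c + y * I) *
        T.zeta q (c + y * I) * (r : ℂ) ^ (-(c + y * I : ℂ)) =
      2 * Real.pi * ((T.symVolume q κ r : ℝ) -
        ∑ l : Fin (d + 1), (κ l * T.sigma q l * r ^ (-poleExponent d q l) : ℝ)) := by
  have hU := T.finite_setOf_lt_wordRatio hr
  have h := T.hasSum_integral_vertical q (b := T.residueCoeff q κ) (e := poleExponent d q)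
    (T.sum_residueCoeff hκ) hc hβ hr
  have hval : ∀ w : List (Fin N), r < T.wordRatio w →
      truncatedPowerSum (T.residueCoeff q κ) (poleExponent d q) (r / T.wordRatio w) =
        ((∑ l, T.residueCoeff q κ l * (r / T.wordRatio w) ^ (-poleExponent d q l) : ℝ) : ℂ) := by
    intro w hw
    have hlt : r / T.wordRatio w ≤ 1 := (div_le_one (T.wordRatio_pos w)).2 hw.le
    rw [truncatedPowerSum, min_eq_left hlt, ofReal_sum]
    refine Finset.sum_congr rfl fun l _ => ?_
    rw [ofReal_mul, ofReal_cpow (div_pos hr (T.wordRatio_pos w)).le, ofReal_neg]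
  have hcount : HasSum (fun w : {w : List (Fin N) // w ≠ []} => 2 * Real.pi *
        (((T.wordProb w ^ q : ℝ) : ℂ) *
          truncatedPowerSum (T.residueCoeff q κ) (poleExponent d q) (r / T.wordRatio w)))
      (∑ w ∈ hU.toFinset, 2 * Real.pi * (((T.wordProb w ^ q : ℝ) : ℂ) *
          truncatedPowerSum (T.residueCoeff q κ) (poleExponent d q) (r / T.wordRatio w))) := by
    set F : List (Fin N) → ℂ := Set.indicator {w | w ≠ []} fun w => 2 * Real.pi *
        (((T.wordProb w ^ q : ℝ) : ℂ) *
          truncatedPowerSum (T.residueCoeff q κ) (poleExponent d q) (r / T.wordRatio w)) with hF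
    have h1 : HasSum F (∑ w ∈ hU.toFinset, F w) := by
      refine hasSum_sum_of_ne_finset_zero fun w hw => ?_
      by_cases hw0 : w = []
      · exact Set.indicator_of_notMem (by simp [hw0]) _
      · have hle : T.wordRatio w ≤ r := by
          by_contra hlt
          exact hw (by simpa [hw0] using hlt)
        rw [hF, Set.indicator_of_mem (by exact hw0), truncatedPowerSum_of_one_le (T.sum_residueCoeff hκ)
          ((one_le_div (T.wordRatio_pos w)).2 hle), mul_zero, mul_zero]
    rw [Finset.sum_congr rfl fun w hw => (show _ = F w from
      (Set.indicator_of_mem (by simp at hw; exact hw.1) _).symm)]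
    exact hasSum_subtype_iff_indicator.2 h1
  rw [h.unique hcount, T.symVolume_eq q κ hκ hr hr1, finsum_mem_eq_finite_toFinset_sum _ hU,
    ← Finset.mul_sum, ofReal_add, ofReal_sum, ofReal_sum, add_sub_cancel_right]
  congr 1
  refine Finset.sum_congr rfl fun w hw => ?_
  rw [hval w (by simp at hw; exact hw.2), ofReal_mul]

end SelfSimilarSystem

end

/-! ### Residues of the modified zeta function and the limit of the contours. -/

noncomputable section

theorem MeromorphicAt.hasResidue_residue {f : ℂ → ℂ} {ω : ℂ} (hf : MeromorphicAt f ω) :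
    HasResidue f ω (residue f ω) := by
  obtain ⟨k, hk⟩ := hf.exists_hasResidue
  rwa [hk.residue_eq]

section simplePoleSum

variable {ι : Type*} [Fintype ι] {b e : ι → ℝ}

theorem norm_simplePoleSum_le_of_le_norm {s : ℂ} {m : ℝ} (hm : 0 < m)
    (h : ∀ l, m ≤ ‖s - e l‖) : ‖simplePoleSum b e s‖ ≤ (∑ l, |b l|) / m := by
  rw [simplePoleSum, Finset.sum_div]
  refine (norm_sum_le _ _).trans (Finset.sum_le_sum fun l _ => ?_)
  rw [norm_div, norm_real, Real.norm_eq_abs]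
  exact div_le_div_of_nonneg_left (abs_nonneg _) hm (h l)

theorem analyticAt_simplePoleSum {s : ℂ} (hs : ∀ l, s ≠ e l) :
    AnalyticAt ℂ (simplePoleSum b e) s :=
  Finset.analyticAt_fun_sum _ fun l _ =>
    analyticAt_const.div (analyticAt_id.sub analyticAt_const) (sub_ne_zero.2 (hs l))

theorem meromorphicAt_simplePoleSum (s : ℂ) : MeromorphicAt (simplePoleSum b e) s :=
  MeromorphicAt.fun_sum fun _ _ => (analyticAt_const.meromorphicAt.div
    (analyticAt_id.sub analyticAt_const).meromorphicAt)

theorem hasResidue_simplePoleSum_mul (he : Function.Injective e) (l : ι) {H : ℂ → ℂ}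
    (hH : AnalyticAt ℂ H (e l)) :
    HasResidue (fun s => simplePoleSum b e s * H s) (e l) (b l * H (e l)) := by
  classical
  refine ⟨fun _ => 0, fun _ => 0, fun s => b l * dslope H (e l) s +
    (∑ j ∈ Finset.univ.erase l, (b j : ℂ) / (s - e j)) * H s, fun z _ => hasDerivAt_const _ _,
    fun z _ => differentiableAt_const _, ?_, ?_⟩
  · refine (analyticAt_const.mul hH.dslope_self).add (AnalyticAt.mul ?_ hH)
    refine Finset.analyticAt_fun_sum _ fun j hj =>
      analyticAt_const.div (analyticAt_id.sub analyticAt_const) (sub_ne_zero.2 ?_)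
    simpa using (he.ne (Finset.ne_of_mem_erase hj)).symm
  · filter_upwards [self_mem_nhdsWithin] with s hs
    have hs' : s - e l ≠ 0 := sub_ne_zero.2 hs
    have h1 : H s = H (e l) + (s - e l) * dslope H (e l) s := by
      rw [← smul_eq_mul, sub_smul_dslope]; ring
    have h2 : simplePoleSum b e s = (b l : ℂ) / (s - e l) +
        ∑ j ∈ Finset.univ.erase l, (b j : ℂ) / (s - e j) :=
      (Finset.add_sum_erase _ _ (Finset.mem_univ l)).symm
    have h3 : (b l : ℂ) / (s - e l) * H s =
        b l * H (e l) * (s - e l)⁻¹ + b l * dslope H (e l) s := by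
      conv_lhs => rw [h1]
      field_simp
    rw [h2, add_mul, h3]
    ring

end simplePoleSum

/-- The bound does not depend on `a`, which lets the left side of the contour move to `-∞`. -/
theorem integral_rpow_neg_le {r : ℝ} (hr : 0 < r) (hr1 : r < 1) (a c : ℝ) :
    ∫ x in a..c, r ^ (-x) ≤ r ^ (-c) / (-Real.log r) := by
  have hlog : Real.log r < 0 := Real.log_neg hr hr1
  have hd : ∀ x ∈ Set.uIcc a c, HasDerivAt (fun x => r ^ (-x) / (-Real.log r)) (r ^ (-x)) x := by
    intro x _
    have := ((hasDerivAt_neg x).const_rpow hr).div_const (-Real.log r)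
    refine this.congr_deriv ?_
    have := hlog.ne
    field_simp
  have hcont : Continuous fun x : ℝ => r ^ (-x) :=
    (Real.continuous_const_rpow hr.ne').comp continuous_neg
  rw [intervalIntegral.integral_eq_sub_of_hasDerivAt hd (hcont.intervalIntegrable _ _)]
  have : 0 ≤ r ^ (-a) / (-Real.log r) :=
    div_nonneg (Real.rpow_nonneg hr.le _) (by linarith)
  linarith

namespace SelfSimilarSystem

variable {d N : ℕ} (T : SelfSimilarSystem d N) (q : ℝ)

theorem ratioMin_lt_one : T.ratioMin < 1 := by
  obtain ⟨i⟩ := T.nonempty_index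
  exact (ciInf_le (Set.finite_range T.ratio).bddBelow i).trans_lt (T.ratio_lt_one i)

theorem poleExponent_injective : Function.Injective (poleExponent d q) := fun l l' h => by
  have : ((l : ℕ) : ℝ) = (l' : ℕ) := by simpa [poleExponent] using h
  exact Fin.ext (Nat.cast_injective this)

theorem modifiedZeta_eq (κ : Fin (d + 1) → ℝ) (s : ℂ) :
    T.modifiedZeta q κ s =
      simplePoleSum (T.residueCoeff q κ) (poleExponent d q) s * T.zeta q s := by
  simp [modifiedZeta, simplePoleSum, residueCoeff, poleExponent]

theorem cpressure_poleExponent (l : Fin (d + 1)) :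
    T.cpressure q (poleExponent d q l) = T.sigma q l := T.cpressure_ofReal q _

variable {q} in
theorem sigma_ne_one (hβ : ∀ l : Fin (d + 1), T.beta q ≠ ((l : ℕ) : ℝ) - d * q)
    (l : Fin (d + 1)) : T.sigma q l ≠ 1 := fun h =>
  hβ l ((T.pressure_strictAnti q).injective ((T.pressure_beta q).trans h.symm))

variable {q} in
-- At `e_l` the zeta function equals `σ / (1 - σ)`, whose denominator cancels the factor `σ - 1`.
-- The assumption on `β(q)` guarantees `σ ≠ 1`.
theorem residueCoeff_mul_zeta (hβ : ∀ l : Fin (d + 1), T.beta q ≠ ((l : ℕ) : ℝ) - d * q)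
    (κ : Fin (d + 1) → ℝ) (l : Fin (d + 1)) :
    (T.residueCoeff q κ l : ℂ) * T.zeta q (poleExponent d q l) = -(κ l * T.sigma q l : ℝ) := by
  have h : (1 : ℂ) - T.sigma q l ≠ 0 := by
    rw [sub_ne_zero]
    exact_mod_cast (T.sigma_ne_one hβ l).symm
  rw [zeta, cpressure_poleExponent, residueCoeff]
  push_cast
  field_simp
  ring

variable {q} in
/-- The residue theorem for `Z^q_μ(s) r^{-s}` on a rectangle whose horizontal sides avoid the poles
of the zeta function. -/
theorem rectIntegral_modifiedZeta (hβ : ∀ l : Fin (d + 1), T.beta q ≠ ((l : ℕ) : ℝ) - d * q)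
    (κ : Fin (d + 1) → ℝ) {r a c t : ℝ} (hr : 0 < r) (ht : 0 < t)
    (ha : ∀ s : ℂ, s.re ≤ a → T.cpressure q s ≠ 1) (hae : ∀ l, a < poleExponent d q l)
    (hc : T.beta q < c) (hce : ∀ l, poleExponent d q l < c)
    (hreg : ∀ x : ℝ, T.cpressure q (x + t * I) ≠ 1 ∧ T.cpressure q (x - t * I) ≠ 1) :
    rectIntegral (fun s => T.modifiedZeta q κ s * (r : ℂ) ^ (-s)) a c (-t) t =
      2 * Real.pi * I * ((∑ᶠ ω ∈ {ω : ℂ | ω ∈ poles (T.zeta q) ∧ |ω.im| ≤ t},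
        residue (fun s : ℂ => T.modifiedZeta q κ s * (r : ℂ) ^ (-s)) ω) -
        ∑ l : Fin (d + 1), (κ l * T.sigma q l * r ^ (-poleExponent d q l) : ℝ)) := by
  classical
  set G : ℂ → ℂ := fun s => T.modifiedZeta q κ s * (r : ℂ) ^ (-s) with hG
  set b := T.residueCoeff q κ
  set e := poleExponent d q
  have hr0 : (r : ℂ) ≠ 0 := ofReal_ne_zero.2 hr.ne'
  have hpow : ∀ s : ℂ, AnalyticAt ℂ (fun s : ℂ => (r : ℂ) ^ (-s)) s := fun s =>
    Differentiable.analyticAt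
      (fun s => (differentiableAt_id.neg).const_cpow (Or.inl hr0)) s
  have hGeq : G = fun s => simplePoleSum b e s * (T.zeta q s * (r : ℂ) ^ (-s)) := by
    ext s
    rw [hG, ← mul_assoc, ← T.modifiedZeta_eq q κ s]
  have hfin : {ω : ℂ | ω ∈ poles (T.zeta q) ∧ |ω.im| ≤ t}.Finite := by
    rw [T.poles_zeta]
    exact T.finite_cpressure_eq_one_of_abs_im_le q t
  have hmem : ∀ ω, ω ∈ hfin.toFinset ↔ T.cpressure q ω = 1 ∧ |ω.im| ≤ t := fun ω => by
    simp [T.poles_zeta]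
  set E : Finset ℂ := Finset.univ.image fun l => (e l : ℂ) with hE
  have hmero : ∀ ω, MeromorphicAt G ω := fun ω => by
    rw [hGeq]
    exact (meromorphicAt_simplePoleSum ω).mul
      ((T.meromorphicAt_zeta q ω).mul (hpow ω).meromorphicAt)
  have hne : ∀ l, T.cpressure q (e l) ≠ 1 := fun l => by
    rw [cpressure_poleExponent]
    exact_mod_cast T.sigma_ne_one hβ l
  -- No exponent is a pole of the zeta function, so the two families of residues add without
  -- overlap.
  have hdisj : Disjoint hfin.toFinset E := by
    rw [Finset.disjoint_left]
    intro ω hω hωE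
    obtain ⟨l, _, rfl⟩ := Finset.mem_image.1 hωE
    exact hne l ((hmem _).1 hω).1
  have hres : ∀ l, residue G (e l) = -(κ l * T.sigma q l * r ^ (-e l) : ℝ) := fun l => by
    have h := hasResidue_simplePoleSum_mul (b := b) (poleExponent_injective q) l
      (H := fun s => T.zeta q s * (r : ℂ) ^ (-s)) ((T.analyticAt_zeta q (hne l)).mul (hpow _))
    rw [hGeq, h.residue_eq, ← mul_assoc, T.residueCoeff_mul_zeta hβ κ l, ofReal_mul _ (r ^ _),
      ofReal_cpow hr.le, ofReal_neg, neg_mul]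
  rw [rectIntegral_eq_sum_residue (by linarith [hae 0, hce 0]) (by linarith) (hfin.toFinset ∪ E)
    (residue G) G ?_ (fun ω _ => (hmero ω).hasResidue_residue) ?_, Finset.sum_union hdisj,
    finsum_mem_eq_finite_toFinset_sum _ hfin, hE, Finset.sum_image fun l _ l' _ h =>
      poleExponent_injective q (ofReal_injective h), Finset.sum_congr rfl fun l _ => hres l,
    Finset.sum_neg_distrib, sub_eq_add_neg, ofReal_sum]
  · intro ω hω
    rcases Finset.mem_union.1 hω with h | h
    · obtain ⟨h1, h2⟩ := (hmem ω).1 h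
      refine ⟨⟨not_le.1 fun h => ha ω h h1, ?_⟩, ?_⟩
      · refine lt_of_le_of_lt (not_lt.1 fun h => ?_) hc
        exact T.cpressure_ne_one_of_beta_lt q h h1
      -- The bound `|ω.im| ≤ t` is strict because the lines `Im s = ±t` carry no pole.
      · refine abs_lt.1 (lt_of_le_of_ne h2 fun h => ?_)
        have hω' : ω = ω.re + ω.im * I := (re_add_im ω).symm
        rcases (abs_eq ht.le).1 h with h | h
        · rw [h] at hω'
          exact (hreg ω.re).1 (hω' ▸ h1)
        · rw [h, ofReal_neg, neg_mul, ← sub_eq_add_neg] at hω'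
          exact (hreg ω.re).2 (hω' ▸ h1)
    · obtain ⟨l, _, rfl⟩ := Finset.mem_image.1 h
      exact ⟨by simpa using ⟨hae l, hce l⟩, by simpa using ht⟩
  · intro z _ hz hzS
    rw [Finset.mem_union, not_or, hmem, hE] at hzS
    have h1 : T.cpressure q z ≠ 1 := fun h => hzS.1 ⟨h, abs_le.2 hz⟩
    have h2 : ∀ l, z ≠ e l := fun l h => hzS.2 (by simp [h])
    rw [hGeq]
    exact ((analyticAt_simplePoleSum h2).mul
      ((T.analyticAt_zeta q h1).mul (hpow z))).differentiableAt

theorem exists_bounds_poleExponent :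
    ∃ m : ℝ, ∀ l, -m ≤ poleExponent d q l ∧ poleExponent d q l ≤ m := by
  obtain ⟨m, hm⟩ := (Set.finite_range fun l => |poleExponent d q l|).bddAbove
  exact ⟨m, fun l => abs_le.1 (hm ⟨l, rfl⟩)⟩

theorem norm_modifiedZeta_mul_le (κ : Fin (d + 1) → ℝ) {r m k : ℝ} (hr : 0 < r) (hm : 0 < m)
    {s : ℂ} (h : ∀ l, m ≤ ‖s - poleExponent d q l‖) (hk : ‖T.zeta q s‖ ≤ k) :
    ‖T.modifiedZeta q κ s * (r : ℂ) ^ (-s)‖ ≤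
      (∑ l, |T.residueCoeff q κ l|) / m * k * r ^ (-s.re) := by
  rw [modifiedZeta_eq, norm_mul, norm_mul, norm_cpow_eq_rpow_re_of_pos hr, neg_re]
  refine mul_le_mul_of_nonneg_right ?_ (Real.rpow_nonneg hr.le _)
  exact mul_le_mul (norm_simplePoleSum_le_of_le_norm hm h) hk (norm_nonneg _)
    (div_nonneg (Finset.sum_nonneg fun _ _ => abs_nonneg _) hm.le)

/-- The exponents are real, so points at height `t` are at distance at least `|t|` from them. -/
theorem norm_integral_horizontal_le (κ : Fin (d + 1) → ℝ) {r a c t k : ℝ} (hr : 0 < r)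
    (hr1 : r < 1) (hac : a ≤ c) (ht : t ≠ 0) (hk : ∀ x ≤ c, ‖T.zeta q (x + t * I)‖ ≤ k) :
    ‖∫ x in a..c, T.modifiedZeta q κ (x + t * I) * (r : ℂ) ^ (-(x + t * I : ℂ))‖ ≤
      (∑ l, |T.residueCoeff q κ l|) / |t| * k * (r ^ (-c) / (-Real.log r)) := by
  have hk0 : 0 ≤ k := (norm_nonneg _).trans (hk c le_rfl)
  have hcont : Continuous fun x : ℝ => (∑ l, |T.residueCoeff q κ l|) / |t| * k * r ^ (-x) :=
    continuous_const.mul ((Real.continuous_const_rpow hr.ne').comp continuous_neg)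
  refine (intervalIntegral.norm_integral_le_of_norm_le
    (g := fun x => (∑ l, |T.residueCoeff q κ l|) / |t| * k * r ^ (-x)) hac
    (Eventually.of_forall fun x hx => ?_) (hcont.intervalIntegrable _ _)).trans ?_
  · have := T.norm_modifiedZeta_mul_le q κ hr (abs_pos.2 ht) (s := x + t * I) (fun l => ?_)
      (hk x hx.2)
    · simpa using this
    · simpa using abs_im_le_norm (x + t * I - poleExponent d q l)
  · rw [intervalIntegral.integral_const_mul]
    exact mul_le_mul_of_nonneg_left (integral_rpow_neg_le hr hr1 a c) (by positivity)

theorem norm_integral_left_le (κ : Fin (d + 1) → ℝ) {r a t : ℝ} (hr : 0 < r)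
    (ht : 0 ≤ t) (ha : ∀ s : ℂ, s.re ≤ a → 2 ≤ ‖T.cpressure q s‖)
    (hae : ∀ l, a + 1 ≤ poleExponent d q l) :
    ‖∫ y in (-t)..t, T.modifiedZeta q κ (a + y * I) * (r : ℂ) ^ (-(a + y * I : ℂ))‖ ≤
      (∑ l, |T.residueCoeff q κ l|) * 2 * r ^ (-a) * (2 * t) := by
  refine (intervalIntegral.norm_integral_le_of_norm_le_const
    (C := (∑ l, |T.residueCoeff q κ l|) * 2 * r ^ (-a)) fun y _ => ?_).trans_eq ?_
  · have := T.norm_modifiedZeta_mul_le q κ hr one_pos (s := a + y * I) (fun l => ?_)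
      (T.norm_zeta_le_two q (ha _ (by simp)))
    · simpa using this
    · refine le_trans ?_ (abs_re_le_norm _)
      simp only [sub_re, add_re, ofReal_re, mul_re, I_re, mul_zero, ofReal_im, I_im, mul_one,
        sub_self, add_zero]
      rw [abs_sub_comm]
      exact (by linarith [hae l] : (1 : ℝ) ≤ poleExponent d q l - a).trans (le_abs_self _)
  · rw [sub_neg_eq_add, ← two_mul, abs_of_nonneg (by linarith)]

variable {q} in
theorem tendsto_sum_residue {κ : Fin (d + 1) → ℝ} (hκ : T.IsConsistent q κ)
    (hβ : ∀ l : Fin (d + 1), T.beta q ≠ ((l : ℕ) : ℝ) - d * q) {t : ℕ → ℝ}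
    (ht : T.IsGrowthSequence q t) {r : ℝ} (hr : 0 < r) (hr1 : r < 1) :
    Tendsto
      (fun n : ℕ => ∑ᶠ ω ∈ {ω : ℂ | ω ∈ poles (T.zeta q) ∧ |ω.im| ≤ t n},
        residue (fun s : ℂ => T.modifiedZeta q κ s * (r : ℂ) ^ (-s)) ω)
      atTop (𝓝 ((T.symVolume q κ r : ℝ) : ℂ)) := by
  obtain ⟨m, hm⟩ := exists_bounds_poleExponent (d := d) q
  obtain ⟨x₀, hx₀⟩ := T.exists_two_le_norm_cpressure q
  -- The line `Re s = c` lies in the half-plane of the series and at least `1` to the right of every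
  -- exponent, as the decay estimate requires.
  obtain ⟨c, hcm, hcβ⟩ : ∃ c, m + 1 ≤ c ∧ T.beta q < c :=
    ⟨max (m + 1) (T.beta q + 1), le_max_left _ _, (lt_add_one _).trans_le (le_max_right _ _)⟩
  -- Left of `-R` the zeta function is bounded by `2` and the exponents are at distance at least
  -- `1`.
  obtain ⟨R, hRm, hRx⟩ : ∃ R, m + 1 ≤ R ∧ -R ≤ x₀ :=
    ⟨max (m + 1) (-x₀), le_max_left _ _, neg_le.1 (le_max_right _ _)⟩
  set B := ∑ l, |T.residueCoeff q κ l|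
  set G : ℂ → ℂ := fun s => T.modifiedZeta q κ s * (r : ℂ) ^ (-s) with hG
  set K : ℂ := ((∑ l : Fin (d + 1), κ l * T.sigma q l * r ^ (-poleExponent d q l) : ℝ) : ℂ)
  obtain ⟨k, hk⟩ := ht.bounded c
  have htinv : Tendsto (fun n => B / |t n| * k * (r ^ (-c) / (-Real.log r))) atTop (𝓝 0) := by
    have : Tendsto (fun n => B / |t n|) atTop (𝓝 0) :=
      tendsto_const_nhds.div_atTop (tendsto_abs_atTop_atTop.comp ht.tendsto)
    simpa using (this.mul_const k).mul_const (r ^ (-c) / (-Real.log r))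
  have hac : ∀ n, -(R + t n) ≤ c := fun n => by
    linarith [ht.pos n, (hm 0).1, (hm 0).2]
  have hbot : Tendsto (fun n => ∫ x in (-(R + t n))..c, G (x + (-t n : ℝ) * I)) atTop (𝓝 0) := by
    refine squeeze_zero_norm (fun n => ?_) htinv
    have := T.norm_integral_horizontal_le q κ hr hr1 (hac n) (neg_ne_zero.2 (ht.pos n).ne')
      (k := k) fun x hx => by simpa [sub_eq_add_neg] using (hk x hx n).2
    rwa [abs_neg] at this
  have htop : Tendsto (fun n => ∫ x in (-(R + t n))..c, G (x + t n * I)) atTop (𝓝 0) :=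
    squeeze_zero_norm (fun n => T.norm_integral_horizontal_le q κ hr hr1 (hac n) (ht.pos n).ne'
      fun x hx => (hk x hx n).1) htinv
  have hleft : Tendsto (fun n => ∫ y in (-t n)..(t n), G ((-(R + t n) : ℝ) + y * I))
      atTop (𝓝 0) := by
    -- The left side recedes together with the height, so the decay of `r ^ x` beats its length `2 *
    -- x`.
    have hlim : Tendsto (fun x : ℝ => B * 2 * r ^ (- -(R + x)) * (2 * x)) atTop (𝓝 0) := by
      have h := (tendsto_rpow_mul_exp_neg_mul_atTop_nhds_zero 1 (-Real.log r)
        (neg_pos.2 (Real.log_neg hr hr1))).const_mul (B * 2 * r ^ R * 2)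
      rw [mul_zero] at h
      refine h.congr fun x => ?_
      rw [neg_neg, neg_neg, Real.rpow_add hr, Real.rpow_one, Real.rpow_def_of_pos hr x]
      ring
    refine squeeze_zero_norm (fun n => ?_) (hlim.comp ht.tendsto)
    refine T.norm_integral_left_le q κ hr (ht.pos n).le (fun s hs => hx₀ s ?_) fun l => ?_
    · linarith [ht.pos n]
    · linarith [ht.pos n, (hm l).1]
  have hce : ∀ l, poleExponent d q l + 1 ≤ c := fun l => by linarith [(hm l).2]
  have hright : Tendsto (fun n => ∫ y in (-t n)..(t n), G (c + y * I)) atTop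
      (𝓝 (2 * Real.pi * (T.symVolume q κ r - K))) := by
    rw [← T.integral_vertical_eq q κ hκ hce hcβ hr hr1]
    simp only [hG, modifiedZeta_eq]
    exact MeasureTheory.intervalIntegral_tendsto_integral
      (T.integrable_vertical_simplePoleSum_mul_zeta q (T.sum_residueCoeff hκ) hce hcβ hr)
      (tendsto_neg_atTop_atBot.comp ht.tendsto) ht.tendsto
  have hrect := ((hbot.sub htop).add (hright.const_mul I)).sub (hleft.const_mul I)
  have hsum : ∀ n, (∑ᶠ ω ∈ {ω : ℂ | ω ∈ poles (T.zeta q) ∧ |ω.im| ≤ t n}, residue G ω) =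
      (2 * Real.pi * I)⁻¹ * rectIntegral G (-(R + t n)) c (-t n) (t n) + K := by
    intro n
    have hn := ht.pos n
    rw [T.rectIntegral_modifiedZeta hβ κ hr hn
      (fun s hs => T.cpressure_ne_one_of_two_le q (hx₀ s (by linarith)))
      (fun l => by linarith [(hm l).1]) hcβ (fun l => by linarith [hce l]) (ht.regular n),
      inv_mul_cancel_left₀ (by simp [Real.pi_ne_zero])]
    ring
  simp only [hsum]
  have hval : (2 * Real.pi * I : ℂ)⁻¹ *
      (0 - 0 + I * (2 * Real.pi * (T.symVolume q κ r - K)) - I * 0) + K = T.symVolume q κ r := by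
    have hπ : (Real.pi : ℂ) ≠ 0 := ofReal_ne_zero.2 Real.pi_ne_zero
    have hI := I_ne_zero
    field_simp
    ring
  rw [← hval]
  exact (hrect.const_mul (2 * Real.pi * I : ℂ)⁻¹).add_const K

end SelfSimilarSystem

end

theorem theorem5p5 {d N : ℕ} (T : SelfSimilarSystem d N) (q : ℝ)
    (κ : Fin (d + 1) → ℝ) (hκ : T.IsConsistent q κ)
    (hβ : ∀ l : Fin (d + 1), T.beta q ≠ ((l : ℕ) : ℝ) - d * q) :
    (∀ τ : ℝ, {ω : ℂ | ω ∈ poles (T.zeta q) ∧ |ω.im| ≤ τ}.Finite) ∧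
    (∃ t : ℕ → ℝ, StrictMono t ∧ T.IsGrowthSequence q t) ∧
    ∀ t : ℕ → ℝ, T.IsGrowthSequence q t →
      ∀ r : ℝ, 0 < r → r < T.ratioMin →
        Tendsto
          (fun n : ℕ => ∑ᶠ ω ∈ {ω : ℂ | ω ∈ poles (T.zeta q) ∧ |ω.im| ≤ t n},
            residue (fun s : ℂ => T.modifiedZeta q κ s * (r : ℂ) ^ (-s)) ω)
          atTop (𝓝 ((T.symVolume q κ r : ℝ) : ℂ)) := by
  refine ⟨fun τ => ?_, T.exists_isGrowthSequence q, fun t ht r hr hr1 =>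
    T.tendsto_sum_residue hκ hβ ht hr (hr1.trans T.ratioMin_lt_one)⟩
  rw [T.poles_zeta]
  exact T.finite_cpressure_eq_one_of_abs_im_le q τ
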